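/- **Notation.** For $j,k\in\mathbb Z$ call $[2^{-j}k,2^{-j}(k+1))$ a dyadic interval of level $j$; let $\mathscr D$ be the set of all dyadic intervals of $\mathbb R$. Let $h_{[0,1)}=\mathbf 1_{[0,1/2)}-\mathbf 1_{[1/2,1)}$ and $h_I(t)=h_{[0,1)}\big((t-\inf I)/|I|\big)$ for $I\in\mathscr D$. For $m\in\mathbb Z$ put $\tau_m(J)=J+m|J|$ for any bounded interval $J$. For $I\in\mathscr D$ of level $j$ put $\sigma^0(I)=I$ and $\sigma^1(I)=I+(-1)^j2^{-j}/3$. A collection of sets is *nested* if any two of its members are disjoint or comparable by inclusion. Call a family $(\mathscr B_i^{(\delta)})$, $0\le i\le K$, $\delta\in\{0,1\}$, of subsets of $\mathscr D$ *admissible for $m$* if its members are pairwise disjoint, their union is $\mathscr D$, and for all $i,\delta$ the collection $\{J,\ \tau_m(J),\ J\cup\tau_m(J) : J=\sigma^\delta(I),\ I\in\mathscr B_i^{(\delta)}\}$ is nested. A Banach space $X$ is UMD (for the exponent $1<p<\infty$) if there is a $\beta\ge 0$ with $\|\sum_j\varepsilon_jd_j\|_{L^p(\Omega;X)}\le\beta\,\|\sum_jd_j\|_{L^p(\Omega;X)}$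 for all finite $X$-valued $L^p$ martingale difference sequences $(d_j)$ on probability spaces and all signs $\varepsilon_j\in\{-1,1\}$; $\mathscr U_p(X)$ is the least such $\beta$. Write $L^p_X=L^p(\mathbb R;X)$. **Theorem.** (a) For every $m\in\mathbb Z$ there are an integer $K=K(m)\ge 0$ with $K(m)\le 7+2\log_2(1+|m|)$ and a family $(\mathscr B_i^{(\delta)})_{0\le i\le K(m),\,\delta\in\{0,1\}}$ admissible for $m$. (b) There is a function $C:\mathbb R\to\mathbb R$ such that the following holds for all $1<p<\infty$, all UMD spaces $X$ and all $m\in\mathbb Z$. There is a unique bounded linear operator $T_m$ on $L^p_X$ with $T_m(h_I\,x)=h_{\tau_m(I)}\,x$ for all $I\in\mathscr D$, $x\in X$. For every family $(\mathscr B_i^{(\delta)})_{0\le i\le K,\,\delta\in\{0,1\}}$ admissible for $m$, the series $$P_i^{(\delta)}u=\sum_{I\in\mathscr B_i^{(\delta)}}\langle u,h_I\rangle\,h_I\,|I|^{-1},\qquad \langle u,h_I\rangle=\int_{\mathbb R}h_I\,u,$$ converges unconditionally in $L^p_X$ for every $u\in L^p_X$ and defines a bounded linear operator $P_i^{(\delta)}$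 on $L^p_X$, and for all $u\in L^p_X$, $0\le i\le K$, $\delta\in\{0,1\}$, $$u=\sum_{\delta\in\{0,1\}}\sum_{i=0}^{K}P_i^{(\delta)}u,\qquad T_mu=\sum_{\delta\in\{0,1\}}\sum_{i=0}^{K}T_mP_i^{(\delta)}u,$$ $$\|T_mP_i^{(\delta)}u\|_{L^p_X}\le C(\mathscr U_p(X))\,\|P_i^{(\delta)}u\|_{L^p_X},\qquad \|T_mP_i^{(\delta)}u\|_{L^p_X}\le C(\mathscr U_p(X))\,\|u\|_{L^p_X}.$$ In particular, with $K=K(m)$ from (a), $T_m$ is a sum of $2(K(m)+1)\le 16+4\log_2(1+|m|)$ pieces bounded uniformly in $m$. -/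

import Mathlib

open MeasureTheory
open scoped ENNReal

noncomputable section

/-- `UMDBound p X β`: for every finite `X`-valued martingale difference sequence in `L^p` of a
probability space and all signs `ε j = ±1`,
`‖∑ ε j d j‖_{L^p} ≤ β ‖∑ d j‖_{L^p}`. -/
def UMDBound (p : ℝ≥0∞) (X : Type*) [NormedAddCommGroup X] [NormedSpace ℝ X] [CompleteSpace X]
    (β : ℝ) : Prop :=
  ∀ (Ω : Type) (mΩ : MeasurableSpace Ω) (μ : Measure Ω), IsProbabilityMeasure μ →
    ∀ (ℱ : Filtration ℕ mΩ) (d : ℕ → Ω → X),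
      (∀ j, StronglyMeasurable[ℱ j] (d j)) →
      (∀ j, MemLp (d j) p μ) →
      (∀ j, μ[d (j + 1) | ℱ j] =ᵐ[μ] 0) →
      ∀ (ε : ℕ → ℝ), (∀ j, ε j = 1 ∨ ε j = -1) →
        ∀ n : ℕ,
          eLpNorm (fun ω => ∑ j ∈ Finset.range n, ε j • d j ω) p μ ≤
            ENNReal.ofReal β * eLpNorm (fun ω => ∑ j ∈ Finset.range n, d j ω) p μ

/-- The UMD property of the Banach space `X`, for the exponent `p`. -/
def IsUMD (p : ℝ≥0∞) (X : Type*) [NormedAddCommGroup X] [NormedSpace ℝ X] [CompleteSpace X] :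
    Prop :=
  ∃ β : ℝ, 0 ≤ β ∧ UMDBound p X β

/-- The UMD constant `𝒰_p(X)`: the least admissible constant. -/
def umdConst (p : ℝ≥0∞) (X : Type*) [NormedAddCommGroup X] [NormedSpace ℝ X] [CompleteSpace X] :
    ℝ :=
  sInf {β : ℝ | 0 ≤ β ∧ UMDBound p X β}

/-- The index `(j, k)` of the dyadic interval `[2^{-j} k, 2^{-j} (k + 1))` of the real line;
different indices give different intervals. -/
@[ext]
structure DyadicInterval where
  scale : ℤ
  pos : ℤ

namespace DyadicInterval

/-- The length `|I| = 2^{-j}`. -/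
def length (I : DyadicInterval) : ℝ := (2 : ℝ) ^ (-I.scale)

/-- The left end point `inf I = 2^{-j} k`. -/
def left (I : DyadicInterval) : ℝ := I.length * (I.pos : ℝ)

/-- The interval itself, as a set of reals. -/
def toSet (I : DyadicInterval) : Set ℝ := Set.Ico I.left (I.left + I.length)

/-- `τ_m(I) = I + m |I|`. -/
def shift (m : ℤ) (I : DyadicInterval) : DyadicInterval := ⟨I.scale, I.pos + m⟩

/-- The one-third shift `s(I) = (-1)^j 2^{-j} / 3`. -/
def oneThird (I : DyadicInterval) : ℝ := (-1 : ℝ) ^ I.scale * I.length / 3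

/-- `σ^δ(I)`, that is `I` for `δ = 0` and `I + s(I)` for `δ = 1`. -/
def sigmaSet (δ : Fin 2) (I : DyadicInterval) : Set ℝ :=
  (fun x => x + ((δ : ℕ) : ℝ) * I.oneThird) '' I.toSet

/-- `τ_m(σ^δ(I)) = σ^δ(I) + m |I|`. -/
def tauSigmaSet (m : ℤ) (δ : Fin 2) (I : DyadicInterval) : Set ℝ :=
  (fun x => x + (m : ℝ) * I.length) '' I.sigmaSet δ

/-- The `L^∞`-normalized Haar function of `[0, 1)`. -/
def haarMother (t : ℝ) : ℝ :=
  (Set.Ico (0 : ℝ) (1 / 2)).indicator 1 t - (Set.Ico (1 / 2 : ℝ) 1).indicator 1 t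

/-- The `L^∞`-normalized Haar function `h_I`. -/
def haar (I : DyadicInterval) (t : ℝ) : ℝ := haarMother ((t - I.left) / I.length)

theorem length_pos (I : DyadicInterval) : 0 < I.length := by
  unfold length
  positivity

theorem shift_toSet (m : ℤ) (I : DyadicInterval) :
    (I.shift m).toSet = I.tauSigmaSet m 0 := by
  have h1 : (I.shift m).length = I.length := rfl
  have h2 : (I.shift m).left = I.left + m * I.length := by
    rw [left, h1, left]
    simp only [shift]
    push_cast
    ring
  simp only [tauSigmaSet, sigmaSet, toSet, h1, h2, Fin.val_zero, Nat.cast_zero, zero_mul,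
    add_zero, Set.image_id', Set.image_add_const_Ico]
  congr 1
  ring

theorem haar_eq (I : DyadicInterval) (t : ℝ) :
    I.haar t = (Set.Ico I.left (I.left + I.length / 2)).indicator (fun _ => (1 : ℝ)) t -
      (Set.Ico (I.left + I.length / 2) (I.left + I.length)).indicator (fun _ => (1 : ℝ)) t := by
  have hl := I.length_pos
  have e1 : (t - I.left) / I.length ∈ Set.Ico (0 : ℝ) (1 / 2) ↔
      t ∈ Set.Ico I.left (I.left + I.length / 2) := by
    simp only [Set.mem_Ico, le_div_iff₀ hl, div_lt_iff₀ hl]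
    constructor <;> rintro ⟨a, b⟩ <;> constructor <;> linarith
  have e2 : (t - I.left) / I.length ∈ Set.Ico (1 / 2 : ℝ) 1 ↔
      t ∈ Set.Ico (I.left + I.length / 2) (I.left + I.length) := by
    simp only [Set.mem_Ico, le_div_iff₀ hl, div_lt_iff₀ hl]
    constructor <;> rintro ⟨a, b⟩ <;> constructor <;> linarith
  classical
  simp only [haar, haarMother, Set.indicator_apply, e1, e2, Pi.one_apply]

theorem memLp_haar_smul {X : Type*} [NormedAddCommGroup X] [NormedSpace ℝ X] (p : ℝ≥0∞)
    (I : DyadicInterval) (x : X) : MemLp (fun t => I.haar t • x) p volume := by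
  have e : (fun t => I.haar t • x) =
      (Set.Ico I.left (I.left + I.length / 2)).indicator (fun _ => x) -
      (Set.Ico (I.left + I.length / 2) (I.left + I.length)).indicator (fun _ => x) := by
    funext t
    classical
    simp only [haar_eq, sub_smul, Pi.sub_apply, Set.indicator_apply, ite_smul, one_smul, zero_smul]
  rw [e]
  refine MemLp.sub ?_ ?_ <;>
    exact memLp_indicator_const p measurableSet_Ico x (Or.inr (by simp))

end DyadicInterval

/-- The function `t ↦ h_I(t) x` as an element of `L^p(ℝ; X)`. -/
def haarLp {X : Type*} [NormedAddCommGroup X] [NormedSpace ℝ X] (p : ℝ≥0∞)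
    (I : DyadicInterval) (x : X) : Lp X p (volume : Measure ℝ) :=
  (DyadicInterval.memLp_haar_smul p I x).toLp _

/-- The Haar coefficient `⟨u, h_I⟩ = ∫ h_I u`. -/
def haarCoeff {X : Type*} [NormedAddCommGroup X] [NormedSpace ℝ X] {p : ℝ≥0∞}
    (I : DyadicInterval) (u : Lp X p (volume : Measure ℝ)) : X :=
  ∫ t, I.haar t • u t

/-- `P u = ∑_{I ∈ 𝓑} ⟨u, h_I⟩ h_I |I|⁻¹` for all `u ∈ L^p(ℝ; X)`, with unconditional
convergence in `L^p(ℝ; X)`. -/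
def IsHaarProjection {X : Type*} [NormedAddCommGroup X] [NormedSpace ℝ X] {p : ℝ≥0∞}
    [Fact (1 ≤ p)] (𝓑 : Set DyadicInterval)
    (P : Lp X p (volume : Measure ℝ) →L[ℝ] Lp X p (volume : Measure ℝ)) : Prop :=
  ∀ u, HasSum
    (fun I : 𝓑 => I.1.length⁻¹ • haarLp p I.1 (haarCoeff I.1 u)) (P u)

/-- `T` is the bounded linear extension of `h_I x ↦ h_{τ_m(I)} x`. -/
def IsShiftOperator {X : Type*} [NormedAddCommGroup X] [NormedSpace ℝ X] {p : ℝ≥0∞}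
    [Fact (1 ≤ p)] (m : ℤ)
    (T : Lp X p (volume : Measure ℝ) →L[ℝ] Lp X p (volume : Measure ℝ)) : Prop :=
  ∀ (I : DyadicInterval) (x : X), T (haarLp p I x) = haarLp p (I.shift m) x

/-- Any two members are comparable by inclusion or disjoint. -/
def IsNested (𝒞 : Set (Set ℝ)) : Prop :=
  ∀ A ∈ 𝒞, ∀ B ∈ 𝒞, A ⊆ B ∨ B ⊆ A ∨ Disjoint A B

/-- The collections `𝓑 δ i`, `δ ∈ {0, 1}`, `0 ≤ i ≤ K`, are pairwise disjoint, exhaust all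
dyadic intervals, and for each `δ`, `i` the collection
`{J, τ_m(J), J ∪ τ_m(J) : J ∈ σ^δ(𝓑 δ i)}` is nested. -/
structure IsShiftDecomposition (m : ℤ) (K : ℕ)
    (𝓑 : Fin 2 → Fin (K + 1) → Set DyadicInterval) : Prop where
  disjoint : Pairwise fun a b : Fin 2 × Fin (K + 1) => Disjoint (𝓑 a.1 a.2) (𝓑 b.1 b.2)
  cover : ⋃ δ, ⋃ i, 𝓑 δ i = Set.univ
  nested : ∀ δ i, IsNested {A : Set ℝ | ∃ I ∈ 𝓑 δ i,
    A = I.sigmaSet δ ∨ A = I.tauSigmaSet m δ ∨ A = I.sigmaSet δ ∪ I.tauSigmaSet m δ}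

end

/-!
The shift `T_m` acts on the Haar expansion by `h_I ↦ h_{τ_m(I)}`.

*Boundedness on a nested class.* Randomize the signs of a finite Haar sum: `∑ ε_I h_I a_I` is
considered on `ℝ × {±1}^s`. By the UMD property the randomized sum has the same `L^p` norm as
`∑ h_I a_I`, up to the UMD constant, and since only the absolute values matter after randomization,
`h_I` may be replaced by the indicator of `I` (`randNorm_congr_abs`). If disjoint sets `A_I`, `B_I`
of equal measure are such that the earlier sets do not separate points of `A_I ∪ B_I`, then the
functions `ε_I 1_{A_I ∪ B_I}` and `ε_I (1_{A_I} - 1_{B_I})` form, in this order, a martingale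
difference sequence. Changing the sign of every second term exchanges `A_I` and `B_I`
(`UMDBound.randNorm_swap`). For a nested class this applies to `J` and `τ_m(J)`, where
`J = σ^δ(I)`: nestedness implies that longer sets do not separate the points of
`J ∪ τ_m(J)` (`mem_sigmaSet_iff_of_isNested`). Working with indicators rather than Haar functions
matters here, as `J ∪ τ_m(J)` may well meet both halves of a longer interval. To pass between `I`
and `σ^1(I)`, note that a half of `σ^1(I)` lies in `I` and a half of `I` lies in `σ^1(I)`, while a
half may be enlarged to the whole interval by the same exchange, applied to the two halves. Together
this gives the bound `(1 + β) ^ 5` (`eLpNorm_haar_shift_le`), which involves no quantity other than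
the UMD constant `β`.

*The classes.* Intervals of level `j` of both systems are the fibres of the integer valued functions
`gridIndex δ j`, and each of these functions determines the ones of smaller level. If `4 ^ l` is at
least `4 (1 + |m|)`, then for each `I` the points of `I ∪ τ_m(I)` lie in one interval `2 l` levels
up, or else this holds for `σ^1(I)`: endpoints of the two systems are about a third of a long
interval apart. Selecting levels modulo `2 l` and the parity of the position in steps of `|m|` gives
`4 l` nested classes for each `δ` (`exists_isShiftDecomposition`).

*Series and operators.* Finite Haar sums are dense in `L^p(ℝ; X)` for `1 < p < ∞`, and by
unconditionality all partial sums of Haar series are bounded uniformly; hence the series converge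
unconditionally, and identities between bounded operators are checked on `h_I x`.
-/

noncomputable section

/-! ### Sign changes of martingale differences -/

/-- The infimum defining the UMD constant is attained. -/
theorem IsUMD.umdBound {p : ℝ≥0∞} {X : Type*} [NormedAddCommGroup X] [NormedSpace ℝ X]
    [CompleteSpace X] (h : IsUMD p X) : UMDBound p X (umdConst p X) := by
  intro Ω mΩ μ hμ ℱ d h1 h2 h3 ε hε n
  set a := eLpNorm (fun ω => ∑ j ∈ Finset.range n, ε j • d j ω) p μ
  set b := eLpNorm (fun ω => ∑ j ∈ Finset.range n, d j ω) p μ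
  have hb : b ≠ ∞ := (memLp_finsetSum (Finset.range n) fun j _ => h2 j).eLpNorm_ne_top
  have ha : a ≠ ∞ :=
    (memLp_finsetSum (Finset.range n) fun j _ => (h2 j).const_smul (ε j)).eLpNorm_ne_top
  have key : ∀ β ∈ {β : ℝ | 0 ≤ β ∧ UMDBound p X β}, a.toReal ≤ β * b.toReal := by
    rintro β ⟨h0, hβ⟩
    have := hβ Ω mΩ μ hμ ℱ d h1 h2 h3 ε hε n
    have := ENNReal.toReal_mono (ENNReal.mul_ne_top ENNReal.ofReal_ne_top hb) this
    rwa [ENNReal.toReal_mul, ENNReal.toReal_ofReal h0] at this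
  have h0 : 0 ≤ umdConst p X := Real.sInf_nonneg fun β hβ => hβ.1
  have hfin : a.toReal ≤ umdConst p X * b.toReal := by
    rcases (ENNReal.toReal_nonneg (a := b)).eq_or_lt with hb0 | hb0
    · obtain ⟨β, hβ⟩ := h
      have := key β hβ
      rw [← hb0] at this ⊢
      simpa using this
    · rw [← div_le_iff₀ hb0]
      exact le_csInf h fun β hβ => (div_le_iff₀ hb0).2 (key β hβ)
  rw [← ENNReal.ofReal_toReal ha, ← ENNReal.ofReal_toReal hb, ← ENNReal.ofReal_mul h0]
  exact ENNReal.ofReal_le_ofReal hfin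

theorem umdConst_nonneg (p : ℝ≥0∞) (X : Type*) [NormedAddCommGroup X] [NormedSpace ℝ X]
    [CompleteSpace X] : 0 ≤ umdConst p X := Real.sInf_nonneg fun _ hβ => hβ.1

/-- The functions `φ i` are the differences of a martingale for their own filtration: `φ i` has
integral zero over every measurable set that is a union of level sets of `(φ j)_{j < i}`. -/
def IsDifferenceSystem {Ω ι : Type*} [MeasurableSpace Ω] [LinearOrder ι] (μ : Measure Ω)
    (φ : ι → Ω → ℝ) : Prop :=
  ∀ i, ∀ S : Set Ω, MeasurableSet S →
    (∀ x y, (∀ j < i, φ j x = φ j y) → x ∈ S → y ∈ S) → ∫ ω in S, φ i ω ∂μ = 0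

/-- The UMD inequality for a finite family `φ i • a i` of differences on a probability space; the
filtration is the one generated by the `φ i`. -/
theorem UMDBound.transform_of_prob {p : ℝ≥0∞} {X : Type*} [NormedAddCommGroup X] [NormedSpace ℝ X]
    [CompleteSpace X] {β : ℝ} (hβ : UMDBound p X β) {Ω ι : Type} [mΩ : MeasurableSpace Ω]
    (μ : Measure Ω) [IsProbabilityMeasure μ] [Fintype ι] [LinearOrder ι] (φ : ι → Ω → ℝ)
    (hm : ∀ i, Measurable (φ i)) (hbd : ∀ i ω, |φ i ω| ≤ 1) (hφ : IsDifferenceSystem μ φ)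
    (a : ι → X) (ε : ι → ℝ) (hε : ∀ i, ε i = 1 ∨ ε i = -1) :
    eLpNorm (fun ω => ∑ i, ε i • φ i ω • a i) p μ ≤
      ENNReal.ofReal β * eLpNorm (fun ω => ∑ i, φ i ω • a i) p μ := by
  classical
  obtain ⟨N, hN⟩ : ∃ N, Fintype.card ι = N := ⟨_, rfl⟩
  let e : Fin N ≃o ι := Fintype.orderIsoFinOfCardEq ι hN
  let Φ : (k : ℕ) → Ω → ({i : ι // (e.symm i : ℕ) ≤ k} → ℝ) := fun k ω i => φ i.1 ω
  have hΦ : ∀ k, Measurable (Φ k) := fun k => measurable_pi_lambda _ fun i => hm i.1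
  let ℱ : Filtration ℕ mΩ :=
    { seq := fun k => MeasurableSpace.comap (Φ k) MeasurableSpace.pi
      mono' := by
        intro k l hkl
        have : Φ k = (fun (v : {i : ι // (e.symm i : ℕ) ≤ l} → ℝ)
            (i : {i : ι // (e.symm i : ℕ) ≤ k}) => v ⟨i.1, i.2.trans hkl⟩) ∘ Φ l := rfl
        change MeasurableSpace.comap (Φ k) _ ≤ MeasurableSpace.comap (Φ l) _
        rw [this, ← MeasurableSpace.comap_comp]
        exact MeasurableSpace.comap_mono
          (measurable_pi_lambda _ fun i => measurable_pi_apply _).comap_le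
      le' := fun k => (hΦ k).comap_le }
  let d : ℕ → Ω → X := fun k ω => if h : k < N then φ (e ⟨k, h⟩) ω • a (e ⟨k, h⟩) else 0
  let η : ℕ → ℝ := fun k => if h : k < N then ε (e ⟨k, h⟩) else 1
  have hmeas : ∀ k, StronglyMeasurable[ℱ k] (d k) := by
    intro k
    by_cases h : k < N
    · simp only [d, h, dif_pos]
      have h1 : Measurable[ℱ k] (φ (e ⟨k, h⟩)) := by
        have : φ (e ⟨k, h⟩) = (fun v : {i : ι // (e.symm i : ℕ) ≤ k} → ℝ =>
            v ⟨e ⟨k, h⟩, by simp⟩) ∘ Φ k := rfl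
        rw [this]
        exact (measurable_pi_apply _).comp (comap_measurable (Φ k))
      exact (h1.stronglyMeasurable).smul_const _
    · simp only [d, h, dif_neg, not_false_eq_true]
      exact stronglyMeasurable_const
  have hLp : ∀ k, MemLp (d k) p μ := by
    intro k
    have hs : StronglyMeasurable (d k) := (hmeas k).mono (ℱ.le k)
    by_cases h : k < N
    · refine MemLp.of_bound hs.aestronglyMeasurable ‖a (e ⟨k, h⟩)‖ (ae_of_all _ fun ω => ?_)
      simp only [d, h, dif_pos, norm_smul, Real.norm_eq_abs]
      exact mul_le_of_le_one_left (norm_nonneg _) (hbd _ _)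
    · simp only [d, h, dif_neg, not_false_eq_true]
      exact MemLp.zero'
  have hint : ∀ i, Integrable (φ i) μ := fun i =>
    Integrable.of_bound (hm i).aestronglyMeasurable 1 (ae_of_all _ fun ω => hbd i ω)
  have hmart : ∀ k, μ[d (k + 1) | ℱ k] =ᵐ[μ] 0 := by
    intro k
    by_cases h : k + 1 < N
    · have hd : d (k + 1) = fun ω => φ (e ⟨k + 1, h⟩) ω • a (e ⟨k + 1, h⟩) := by
        funext ω; simp only [d, h, dif_pos]
      symm
      refine ae_eq_condExp_of_forall_setIntegral_eq (ℱ.le k) ?_ ?_ ?_ ?_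
      · rw [hd]; exact (hint _).smul_const _
      · intro s _ _; exact integrableOn_zero
      · intro S hS _
        obtain ⟨V, hV, rfl⟩ := hS
        simp only [hd, Pi.zero_apply, integral_zero]
        rw [integral_smul_const, hφ (e ⟨k + 1, h⟩) _ ((hΦ k) hV), zero_smul]
        intro x y hxy hx
        have : Φ k x = Φ k y := by
          funext i
          refine hxy i.1 ?_
          rw [← e.symm_apply_lt]
          exact Fin.lt_def.2 (Nat.lt_succ_of_le i.2)
        simpa [Set.mem_preimage, this] using hx
      · exact aestronglyMeasurable_const
    · have hd : d (k + 1) = 0 := by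
        funext ω; simp only [d, h, dif_neg, not_false_eq_true, Pi.zero_apply]
      rw [hd, condExp_zero]
  have hη : ∀ k, η k = 1 ∨ η k = -1 := by
    intro k
    by_cases h : k < N
    · simp only [η, h, dif_pos]; exact hε _
    · simp [η, h]
  have main := hβ Ω mΩ μ inferInstance ℱ d hmeas hLp hmart η hη N
  have e1 : (fun ω => ∑ j ∈ Finset.range N, η j • d j ω) = fun ω => ∑ i, ε i • φ i ω • a i := by
    funext ω
    rw [Finset.sum_range, ← e.toEquiv.sum_comp]
    simp [d, η]
  have e2 : (fun ω => ∑ j ∈ Finset.range N, d j ω) = fun ω => ∑ i, φ i ω • a i := by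
    funext ω
    rw [Finset.sum_range, ← e.toEquiv.sum_comp]
    simp [d]
  rwa [e1, e2] at main

/-- Sign changes of the terms of a martingale difference sequence `φ i • a i` on an arbitrary
measure space. -/
theorem UMDBound.transform {p : ℝ≥0∞} {X : Type*} [NormedAddCommGroup X] [NormedSpace ℝ X]
    [CompleteSpace X] {β : ℝ} (hβ : UMDBound p X β) (hp : p ≠ ∞) {Ω ι : Type}
    [MeasurableSpace Ω]
    (μ : Measure Ω) [Fintype ι] [LinearOrder ι] (φ : ι → Ω → ℝ)
    (hm : ∀ i, Measurable (φ i)) (hbd : ∀ i ω, |φ i ω| ≤ 1)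
    (hfin : ∀ i, μ (Function.support (φ i)) < ∞) (hφ : IsDifferenceSystem μ φ)
    (a : ι → X) (ε : ι → ℝ) (hε : ∀ i, ε i = 1 ∨ ε i = -1) :
    eLpNorm (fun ω => ∑ i, ε i • φ i ω • a i) p μ ≤
      ENNReal.ofReal β * eLpNorm (fun ω => ∑ i, φ i ω • a i) p μ := by
  set Q : Set Ω := ⋃ i, Function.support (φ i) with hQdef
  have hQ : MeasurableSet Q := MeasurableSet.iUnion fun i => measurableSet_support (hm i)
  have hQfin : μ Q < ∞ := by
    refine (measure_iUnion_le _).trans_lt ?_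
    rw [tsum_fintype]
    exact ENNReal.sum_lt_top.2 fun i _ => hfin i
  have hz : ∀ i, ∀ ω ∉ Q, φ i ω = 0 := by
    intro i ω hω
    by_contra h
    exact hω (Set.mem_iUnion.2 ⟨i, h⟩)
  have hr : ∀ f : Ω → X, (∀ ω ∉ Q, f ω = 0) → eLpNorm f p (μ.restrict Q) = eLpNorm f p μ := by
    intro f hf
    refine eLpNorm_restrict_eq_of_support_subset ?_
    intro ω hω
    by_contra h
    exact hω (hf ω h)
  rw [← hr _ fun ω hω => by simp [hz _ ω hω], ← hr _ fun ω hω => by simp [hz _ ω hω]]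
  rcases eq_or_ne (μ Q) 0 with h0 | h0
  · rw [Measure.restrict_eq_zero.2 h0]
    simp
  set c := μ Q
  have hprob : IsProbabilityMeasure (c⁻¹ • μ.restrict Q) :=
    ⟨by simp [c, ENNReal.inv_mul_cancel h0 hQfin.ne]⟩
  have hc : c⁻¹ ≠ 0 := ENNReal.inv_ne_zero.2 hQfin.ne
  have hc' : c⁻¹ ≠ ∞ := ENNReal.inv_ne_top.2 h0
  have hds : IsDifferenceSystem (c⁻¹ • μ.restrict Q) φ := by
    intro i S hS hsat
    rw [Measure.restrict_smul, integral_smul_measure, Measure.restrict_restrict hS,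
      ← setIntegral_eq_of_subset_of_forall_sdiff_eq_zero hS Set.inter_subset_left, hφ i S hS hsat,
      smul_zero]
    intro x hx
    exact hz i x fun h => hx.2 ⟨hx.1, h⟩
  have key := hβ.transform_of_prob (c⁻¹ • μ.restrict Q) φ hm hbd hds a ε hε
  rw [eLpNorm_smul_measure_of_ne_top hp, eLpNorm_smul_measure_of_ne_top hp, smul_eq_mul,
    smul_eq_mul, mul_left_comm] at key
  refine (ENNReal.mul_le_mul_iff_right ?_ ?_).1 key
  · simp [hc, hc']
  · exact ENNReal.rpow_ne_top_of_nonneg (by positivity) hc'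

/-! ### Randomized sums and the exchange of sets -/

/-- The sign `±1` coded by a Boolean. -/
def boolSign (b : Bool) : ℝ := if b then 1 else -1

theorem boolSign_eq (b : Bool) : boolSign b = 1 ∨ boolSign b = -1 := by
  cases b <;> simp [boolSign]

theorem boolSign_not (b : Bool) : boolSign (!b) = -boolSign b := by
  cases b <;> simp [boolSign]

theorem abs_boolSign (b : Bool) : |boolSign b| = 1 := by
  cases b <;> simp [boolSign]

theorem boolSign_mul_self (b : Bool) : boolSign b * boolSign b = 1 := by
  cases b <;> simp [boolSign]

/-- The uniform probability measure on the choices of signs `ι → {±1}`. -/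
def signMeasure (ι : Type) [Fintype ι] [DecidableEq ι] : Measure (ι → Bool) :=
  (Fintype.card (ι → Bool) : ℝ≥0∞)⁻¹ • Measure.count

section

variable {ι : Type} [Fintype ι]

theorem measurable_boolSign_comp (i : ι) :
    Measurable fun ω : ℝ × (ι → Bool) => boolSign (ω.2 i) :=
  (Measurable.of_discrete (f := fun ε : ι → Bool => boolSign (ε i))).comp measurable_snd

variable {X : Type*} [NormedAddCommGroup X] [NormedSpace ℝ X] {p : ℝ≥0∞}

/-- The randomized sum `∑ ε i g i(t) a i` as a function of `(t, ε)`. -/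
def randSum (g : ι → ℝ → ℝ) (a : ι → X) (ω : ℝ × (ι → Bool)) : X :=
  ∑ i, boolSign (ω.2 i) • g i ω.1 • a i

theorem stronglyMeasurable_randSum {g : ι → ℝ → ℝ} (hg : ∀ i, Measurable (g i)) (a : ι → X) :
    StronglyMeasurable (randSum g a) := by
  refine Finset.stronglyMeasurable_fun_sum _ fun i _ => ?_
  exact (measurable_boolSign_comp i).stronglyMeasurable.smul
    (((hg i).comp measurable_fst).stronglyMeasurable.smul_const (a i))

theorem measurable_enorm_randSum {g : ι → ℝ → ℝ} (hg : ∀ i, Measurable (g i)) (a : ι → X) :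
    Measurable fun ω => ‖randSum g a ω‖ₑ ^ p.toReal :=
  (stronglyMeasurable_randSum hg a).enorm.pow_const _

variable [DecidableEq ι]

theorem card_signs_ne_zero : (Fintype.card (ι → Bool) : ℝ≥0∞) ≠ 0 := by
  simp

theorem card_signs_ne_top : (Fintype.card (ι → Bool) : ℝ≥0∞) ≠ ∞ := ENNReal.natCast_ne_top _

instance : IsProbabilityMeasure (signMeasure ι) := by
  constructor
  rw [signMeasure, Measure.smul_apply, smul_eq_mul, Measure.count_apply MeasurableSet.univ,
    Set.encard_univ, ENat.card_eq_coe_fintype_card, ENat.toENNReal_coe]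
  exact ENNReal.inv_mul_cancel card_signs_ne_zero card_signs_ne_top

theorem lintegral_signMeasure (f : (ι → Bool) → ℝ≥0∞) :
    ∫⁻ ε, f ε ∂signMeasure ι = (Fintype.card (ι → Bool) : ℝ≥0∞)⁻¹ * ∑ ε, f ε := by
  rw [signMeasure, lintegral_smul_measure, lintegral_count, tsum_fintype, smul_eq_mul]

theorem integral_signMeasure (f : (ι → Bool) → ℝ) :
    ∫ ε, f ε ∂signMeasure ι = (Fintype.card (ι → Bool) : ℝ)⁻¹ * ∑ ε, f ε := by
  rw [signMeasure, integral_smul_measure, integral_count, smul_eq_mul]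
  simp

/-- The norm of the randomized sum `∑ ε i g i a i` in `L^p(ℝ × {±1}^ι)`. -/
def randNorm (p : ℝ≥0∞) (g : ι → ℝ → ℝ) (a : ι → X) : ℝ≥0∞ :=
  eLpNorm (randSum g a) p ((volume : Measure ℝ).prod (signMeasure ι))

theorem randNorm_rpow (h0 : p ≠ 0) (ht : p ≠ ∞) (g : ι → ℝ → ℝ) (a : ι → X) :
    randNorm p g a ^ p.toReal =
      ∫⁻ ω, ‖randSum g a ω‖ₑ ^ p.toReal ∂(volume : Measure ℝ).prod (signMeasure ι) := by
  rw [randNorm, eLpNorm_eq_lintegral_rpow_enorm_toReal h0 ht, ← ENNReal.rpow_mul,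
    one_div_mul_cancel (ENNReal.toReal_pos h0 ht).ne', ENNReal.rpow_one]

theorem randNorm_rpow_eq_sum (h0 : p ≠ 0) (ht : p ≠ ∞) {g : ι → ℝ → ℝ}
    (hg : ∀ i, Measurable (g i)) (a : ι → X) :
    randNorm p g a ^ p.toReal = ∫⁻ ε,
      eLpNorm (fun t => ∑ i, boolSign (ε i) • g i t • a i) p volume ^ p.toReal
        ∂signMeasure ι := by
  rw [randNorm_rpow h0 ht, lintegral_prod_symm' _ (measurable_enorm_randSum hg a)]
  congr 1
  funext ε
  rw [eLpNorm_eq_lintegral_rpow_enorm_toReal h0 ht, ← ENNReal.rpow_mul,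
    one_div_mul_cancel (ENNReal.toReal_pos h0 ht).ne', ENNReal.rpow_one]
  rfl

theorem randNorm_le (h0 : p ≠ 0) (ht : p ≠ ∞) {g : ι → ℝ → ℝ}
    (hg : ∀ i, Measurable (g i)) (a : ι → X) {K : ℝ≥0∞}
    (h : ∀ ε : ι → Bool, eLpNorm (fun t => ∑ i, boolSign (ε i) • g i t • a i) p volume ≤ K) :
    randNorm p g a ≤ K := by
  rw [← ENNReal.rpow_le_rpow_iff (ENNReal.toReal_pos h0 ht), randNorm_rpow_eq_sum h0 ht hg]
  calc _ ≤ ∫⁻ _, K ^ p.toReal ∂signMeasure ι :=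
        lintegral_mono fun ε => ENNReal.rpow_le_rpow (h ε) ENNReal.toReal_nonneg
    _ = K ^ p.toReal := by simp

theorem le_randNorm (h0 : p ≠ 0) (ht : p ≠ ∞) {g : ι → ℝ → ℝ}
    (hg : ∀ i, Measurable (g i)) (a : ι → X) {K : ℝ≥0∞}
    (h : ∀ ε : ι → Bool, K ≤ eLpNorm (fun t => ∑ i, boolSign (ε i) • g i t • a i) p volume) :
    K ≤ randNorm p g a := by
  rw [← ENNReal.rpow_le_rpow_iff (ENNReal.toReal_pos h0 ht), randNorm_rpow_eq_sum h0 ht hg]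
  calc K ^ p.toReal = ∫⁻ _, K ^ p.toReal ∂signMeasure ι := by simp
    _ ≤ _ := lintegral_mono fun ε => ENNReal.rpow_le_rpow (h ε) ENNReal.toReal_nonneg

/-- At every fixed point `t`, the distribution of `∑ ε i g i(t) a i` depends on `|g i(t)|` only. -/
theorem randNorm_congr_abs (h0 : p ≠ 0) (ht : p ≠ ∞) {g g' : ι → ℝ → ℝ}
    (hg : ∀ i, Measurable (g i)) (hg' : ∀ i, Measurable (g' i))
    (h : ∀ i t, |g' i t| = |g i t|) (a : ι → X) : randNorm p g' a = randNorm p g a := by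
  rw [← (ENNReal.rpow_left_injective (ENNReal.toReal_pos h0 ht).ne').eq_iff]
  simp only [randNorm_rpow h0 ht]
  rw [lintegral_prod _ (measurable_enorm_randSum hg' a).aemeasurable,
    lintegral_prod _ (measurable_enorm_randSum hg a).aemeasurable]
  congr 1
  funext t
  simp only [lintegral_signMeasure]
  congr 1
  let θ : ι → Bool := fun i => decide (g' i t ≠ g i t)
  let e : (ι → Bool) ≃ (ι → Bool) :=
    { toFun := fun ε i => xor (ε i) (θ i)
      invFun := fun ε i => xor (ε i) (θ i)
      left_inv := fun ε => by funext i; simp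
      right_inv := fun ε => by funext i; simp }
  rw [← e.sum_comp]
  refine Finset.sum_congr rfl fun ε _ => ?_
  congr 2
  refine Finset.sum_congr rfl fun i _ => ?_
  by_cases hi : g' i t = g i t
  · simp [e, θ, hi]
  · have h1 : g' i t = -g i t := (abs_eq_abs.1 (h i t)).resolve_left hi
    have h2 : e ε i = !(ε i) := by simp [e, θ, hi]
    simp only [h1, h2, boolSign_not, neg_smul, smul_neg, neg_neg]

theorem randNorm_add_le [Fact (1 ≤ p)] {g g' : ι → ℝ → ℝ}
    (hg : ∀ i, Measurable (g i)) (hg' : ∀ i, Measurable (g' i)) (a : ι → X) :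
    randNorm p (fun i t => g i t + g' i t) a ≤ randNorm p g a + randNorm p g' a := by
  refine le_trans (le_of_eq ?_)
    (eLpNorm_add_le (stronglyMeasurable_randSum hg a).aestronglyMeasurable
      (stronglyMeasurable_randSum hg' a).aestronglyMeasurable Fact.out)
  rw [randNorm]
  congr 1
  funext ω
  simp [randSum, add_smul, Finset.sum_add_distrib]

theorem randNorm_const_mul (c : ℝ) (g : ι → ℝ → ℝ) (a : ι → X) :
    randNorm p (fun i t => c * g i t) a = ‖c‖ₑ * randNorm p g a := by
  rw [randNorm, randNorm, ← eLpNorm_const_smul]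
  congr 1
  funext ω
  simp only [randSum, Pi.smul_apply, Finset.smul_sum]
  refine Finset.sum_congr rfl fun i _ => ?_
  rw [mul_smul, smul_comm]

/-- The contraction principle for coefficients in `{0, 1}`. -/
theorem randNorm_indicator_mono [Fact (1 ≤ p)] (ht : p ≠ ∞) {A B : ι → Set ℝ}
    (hA : ∀ i, MeasurableSet (A i)) (hB : ∀ i, MeasurableSet (B i)) (hAB : ∀ i, A i ⊆ B i)
    (a : ι → X) :
    randNorm p (fun i => (A i).indicator 1) a ≤ randNorm p (fun i => (B i).indicator 1) a := by
  have h0 : p ≠ 0 := (one_pos.trans_le (Fact.out : 1 ≤ p)).ne'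
  have mA : ∀ i, Measurable ((A i).indicator (1 : ℝ → ℝ)) := fun i =>
    measurable_one.indicator (hA i)
  have mB : ∀ i, Measurable ((B i).indicator (1 : ℝ → ℝ)) := fun i =>
    measurable_one.indicator (hB i)
  -- `1_A` is the mean of `1_B` and of `2 * 1_A - 1_B`, which has the same absolute value as `1_B`
  set k : ι → ℝ → ℝ := fun i t => 2 * (A i).indicator 1 t - (B i).indicator 1 t with hk
  have mk : ∀ i, Measurable (k i) := fun i => ((mA i).const_mul 2).sub (mB i)
  have e1 : randNorm p k a = randNorm p (fun i => (B i).indicator 1) a := by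
    refine randNorm_congr_abs h0 ht mB mk (fun i t => ?_) a
    by_cases h : t ∈ A i
    · simp only [hk, h, hAB i h, Set.indicator_of_mem, Pi.one_apply]; norm_num
    · simp [hk, h]
  have e2 : randNorm p (fun i t => 2 * (A i).indicator 1 t) a ≤
      randNorm p k a + randNorm p (fun i => (B i).indicator 1) a := by
    refine le_trans (le_of_eq ?_) (randNorm_add_le mk mB a)
    congr 1
    funext i t
    simp [hk]
  rw [e1, ← two_mul, randNorm_const_mul] at e2
  have h2 : ‖(2 : ℝ)‖ₑ = 2 := by
    rw [Real.enorm_eq_ofReal (by norm_num)]; simp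
  rw [h2] at e2
  exact (ENNReal.mul_le_mul_iff_right (by norm_num) (by norm_num)).1 e2

end

section

variable {ι : Type}

/-- The functions `ε i 1_{A i ∪ B i}` and `ε i (1_{A i} - 1_{B i})`, on `ℝ × {±1}^ι`. -/
def swapSystem (A B : ι → Set ℝ) (k : ι ×ₗ Bool) (ω : ℝ × (ι → Bool)) : ℝ :=
  boolSign (ω.2 (ofLex k).1) * ((A (ofLex k).1).indicator 1 ω.1 +
    (if (ofLex k).2 then -1 else 1) * (B (ofLex k).1).indicator 1 ω.1)

theorem swapSystem_eq_zero {A B : ι → Set ℝ} {k : ι ×ₗ Bool} {ω : ℝ × (ι → Bool)}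
    (h : ω.1 ∉ A (ofLex k).1 ∪ B (ofLex k).1) : swapSystem A B k ω = 0 := by
  simp only [Set.mem_union, not_or] at h
  simp [swapSystem, h.1, h.2]

theorem abs_swapSystem_le {A B : ι → Set ℝ} (hd : ∀ i, Disjoint (A i) (B i))
    (k : ι ×ₗ Bool) (ω : ℝ × (ι → Bool)) : |swapSystem A B k ω| ≤ 1 := by
  rw [swapSystem, abs_mul, abs_boolSign, one_mul]
  by_cases h1 : ω.1 ∈ A (ofLex k).1
  · have h2 := Set.disjoint_left.1 (hd _) h1
    simp [h1, h2]
  · by_cases h2 : ω.1 ∈ B (ofLex k).1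
    · simp only [h1, h2, not_false_eq_true, Set.indicator_of_notMem, Set.indicator_of_mem,
        Pi.one_apply, zero_add, mul_one]
      split_ifs <;> simp
    · simp [h1, h2]

theorem measurable_swapSystem [Fintype ι] {A B : ι → Set ℝ} (hA : ∀ i, MeasurableSet (A i))
    (hB : ∀ i, MeasurableSet (B i)) (k : ι ×ₗ Bool) : Measurable (swapSystem A B k) :=
  (measurable_boolSign_comp _).mul
    (((measurable_one.indicator (hA _)).comp measurable_fst).add
      (((measurable_one.indicator (hB _)).comp measurable_fst).const_mul _))

end

section

variable {ι : Type} [Fintype ι] [LinearOrder ι] {X : Type*} [NormedAddCommGroup X]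
  [NormedSpace ℝ X] [CompleteSpace X] {p : ℝ≥0∞}

theorem measure_support_swapSystem_lt_top {A B : ι → Set ℝ} (hfA : ∀ i, volume (A i) ≠ ∞)
    (hAB : ∀ i, volume (A i) = volume (B i)) (k : ι ×ₗ Bool) :
    (volume : Measure ℝ).prod (signMeasure ι) (Function.support (swapSystem A B k)) < ∞ := by
  have h1 : Function.support (swapSystem A B k) ⊆
      (A (ofLex k).1 ∪ B (ofLex k).1) ×ˢ Set.univ := by
    intro ω hω
    refine ⟨?_, trivial⟩
    by_contra h
    exact hω (swapSystem_eq_zero h)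
  refine (measure_mono h1).trans_lt ?_
  rw [Measure.prod_prod, measure_univ, mul_one]
  refine (measure_union_le _ _).trans_lt ?_
  rw [← hAB]
  exact ENNReal.add_lt_top.2 ⟨(hfA _).lt_top, (hfA _).lt_top⟩

theorem isDifferenceSystem_swapSystem {A B : ι → Set ℝ}
    (hA : ∀ i, MeasurableSet (A i)) (hB : ∀ i, MeasurableSet (B i))
    (hfA : ∀ i, volume (A i) ≠ ∞) (hAB : ∀ i, volume (A i) = volume (B i))
    (hd : ∀ i, Disjoint (A i) (B i))
    (hconst : ∀ i, ∀ j < i, ∀ x ∈ A i ∪ B i, ∀ y ∈ A i ∪ B i,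
      (x ∈ A j ↔ y ∈ A j) ∧ (x ∈ B j ↔ y ∈ B j)) :
    IsDifferenceSystem ((volume : Measure ℝ).prod (signMeasure ι)) (swapSystem A B) := by
  intro k S hS hsat
  have hint : Integrable (S.indicator (swapSystem A B k))
      ((volume : Measure ℝ).prod (signMeasure ι)) := by
    refine Integrable.indicator ?_ hS
    rw [← integrableOn_iff_integrable_of_support_subset
      (Set.Subset.refl (Function.support (swapSystem A B k)))]
    exact Measure.integrableOn_of_bounded (measure_support_swapSystem_lt_top hfA hAB k).ne
      (measurable_swapSystem hA hB k).aestronglyMeasurable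
      (M := 1) (ae_of_all _ fun ω => abs_swapSystem_le hd k ω)
  rw [← integral_indicator hS]
  obtain ⟨⟨i, b⟩, rfl⟩ := (toLex : ι × Bool ≃ ι ×ₗ Bool).surjective k
  cases b with
  | false =>
    -- changing the sign `ε i` preserves `S` and changes the sign of the function
    rw [integral_prod _ hint]
    refine integral_eq_zero_of_ae (ae_of_all _ fun t => ?_)
    simp only [Pi.zero_apply, integral_signMeasure]
    let f : (ι → Bool) → (ι → Bool) := fun ε => Function.update ε i (!(ε i))
    have hff : Function.Involutive f := fun ε => by simp [f]
    have hS' : ∀ ε, (t, ε) ∈ S → (t, f ε) ∈ S := by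
      intro ε
      refine hsat (t, ε) (t, f ε) fun j hj => ?_
      have hji : (ofLex j).1 < i := by
        rcases Prod.Lex.lt_iff.1 hj with h | h
        · exact h
        · exact absurd h.2 (not_lt_of_ge (Bool.false_le _))
      simp [swapSystem, f, hji.ne]
    have hsum : ∑ ε, S.indicator (swapSystem A B (toLex (i, false))) (t, ε) =
        -∑ ε, S.indicator (swapSystem A B (toLex (i, false))) (t, ε) := by
      rw [← Finset.sum_neg_distrib, ← Equiv.sum_comp hff.toPerm]
      refine Finset.sum_congr rfl fun ε _ => ?_
      change S.indicator _ (t, f ε) = _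
      by_cases h : (t, ε) ∈ S
      · rw [Set.indicator_of_mem h, Set.indicator_of_mem (hS' ε h)]
        have : f ε i = !(ε i) := by simp [f]
        change boolSign (f ε i) * _ = -(boolSign (ε i) * _)
        rw [this, boolSign_not, neg_mul]
      · have h' : (t, f ε) ∉ S := fun h' => h (by simpa [hff ε] using hS' _ h')
        rw [Set.indicator_of_notMem h, Set.indicator_of_notMem h', neg_zero]
    have h0 : ∑ ε, S.indicator (swapSystem A B (toLex (i, false))) (t, ε) = 0 := by linarith
    exact mul_eq_zero_of_right _ h0
  | true =>
    -- for fixed `ε`, the section of `S` contains all or nothing of `A i ∪ B i`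
    rw [integral_prod_symm _ hint]
    refine integral_eq_zero_of_ae (ae_of_all _ fun ε => ?_)
    by_cases hex : ∃ t ∈ A i ∪ B i, (t, ε) ∈ S
    · obtain ⟨t, ht, htS⟩ := hex
      have hall : ∀ s ∈ A i ∪ B i, (s, ε) ∈ S := by
        intro s hs
        refine hsat (t, ε) (s, ε) (fun j hj => ?_) htS
        rcases Prod.Lex.lt_iff.1 hj with h | h
        · obtain ⟨h1, h2⟩ := hconst i _ h t ht s hs
          change boolSign (ε (ofLex j).1) * ((A (ofLex j).1).indicator 1 t + _ *
              (B (ofLex j).1).indicator 1 t) =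
            boolSign (ε (ofLex j).1) * ((A (ofLex j).1).indicator 1 s + _ *
              (B (ofLex j).1).indicator 1 s)
          classical
          simp only [Set.indicator_apply, h1, h2, Pi.one_apply]
        · obtain ⟨j, b⟩ := j
          obtain ⟨rfl, h⟩ : j = i ∧ b < true := h
          obtain rfl : b = false := by cases b <;> simp_all
          have key : ∀ x ∈ A j ∪ B j,
              swapSystem A B (toLex (j, false)) (x, ε) = boolSign (ε j) := by
            intro x hx
            change boolSign (ε j) * ((A j).indicator 1 x + 1 * (B j).indicator 1 x) = _
            rcases hx with hx | hx
            · simp [hx, Set.disjoint_left.1 (hd j) hx]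
            · simp [hx, Set.disjoint_right.1 (hd j) hx]
          exact (key t ht).trans (key s hs).symm
      have e : (fun s => S.indicator (swapSystem A B (toLex (i, true))) (s, ε)) =
          fun s => boolSign (ε i) * ((A i).indicator 1 s - (B i).indicator 1 s) := by
        funext s
        have h1 : swapSystem A B (toLex (i, true)) (s, ε) =
            boolSign (ε i) * ((A i).indicator 1 s - (B i).indicator 1 s) := by
          change boolSign (ε i) * ((A i).indicator 1 s + -1 * (B i).indicator 1 s) = _
          ring
        by_cases hs : (s, ε) ∈ S
        · rw [Set.indicator_of_mem hs, h1]
        · have hs' : s ∉ A i ∪ B i := fun h => hs (hall s h)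
          simp only [Set.mem_union, not_or] at hs'
          rw [Set.indicator_of_notMem hs]
          simp [hs'.1, hs'.2]
      have iA : Integrable ((A i).indicator (1 : ℝ → ℝ)) :=
        (integrable_indicator_iff (hA i)).2 (integrableOn_const (hfA i))
      have iB : Integrable ((B i).indicator (1 : ℝ → ℝ)) :=
        (integrable_indicator_iff (hB i)).2 (integrableOn_const (hAB i ▸ hfA i))
      simp only [e, Pi.zero_apply]
      rw [integral_const_mul, integral_sub iA iB, integral_indicator_one (hA i),
        integral_indicator_one (hB i), measureReal_def, measureReal_def, hAB i]
      simp
    · refine integral_eq_zero_of_ae (ae_of_all _ fun s => ?_)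
      change S.indicator _ (s, ε) = 0
      by_cases hs : (s, ε) ∈ S
      · rw [Set.indicator_of_mem hs]
        exact swapSystem_eq_zero fun h => hex ⟨s, h, hs⟩
      · exact Set.indicator_of_notMem hs _

/-- If the sets `A i`, `B i` are disjoint and of equal measure, and the earlier sets do not
separate points of `A i ∪ B i`, then `A i` may be replaced by `B i` in a randomized sum: up to the
factor `1/2`, the indicators of `A i` and `B i` are the sum and the difference of
`1_{A i ∪ B i}` and `1_{A i} - 1_{B i}`, which after randomization are consecutive terms of a
martingale difference sequence. -/
theorem UMDBound.randNorm_swap {β : ℝ} (hβ : UMDBound p X β) (ht : p ≠ ∞)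
    {A B : ι → Set ℝ} (hA : ∀ i, MeasurableSet (A i)) (hB : ∀ i, MeasurableSet (B i))
    (hfA : ∀ i, volume (A i) ≠ ∞) (hAB : ∀ i, volume (A i) = volume (B i))
    (hd : ∀ i, Disjoint (A i) (B i))
    (hconst : ∀ i, ∀ j < i, ∀ x ∈ A i ∪ B i, ∀ y ∈ A i ∪ B i,
      (x ∈ A j ↔ y ∈ A j) ∧ (x ∈ B j ↔ y ∈ B j)) (a : ι → X) :
    randNorm p (fun i => (B i).indicator 1) a ≤
      ENNReal.ofReal β * randNorm p (fun i => (A i).indicator 1) a := by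
  have key := hβ.transform ht ((volume : Measure ℝ).prod (signMeasure ι)) (swapSystem A B)
    (measurable_swapSystem hA hB) (abs_swapSystem_le hd)
    (measure_support_swapSystem_lt_top hfA hAB)
    (isDifferenceSystem_swapSystem hA hB hfA hAB hd hconst)
    (fun k => (1 / 2 : ℝ) • a (ofLex k).1) (fun k => if (ofLex k).2 then -1 else 1)
    (fun k => by split_ifs <;> simp)
  refine le_trans (le_of_eq ?_) (key.trans (le_of_eq ?_))
  · rw [randNorm]
    congr 1
    funext ω
    rw [← (toLex : ι × Bool ≃ ι ×ₗ Bool).sum_comp, Fintype.sum_prod_type, randSum]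
    refine Finset.sum_congr rfl fun i _ => ?_
    simp only [Fintype.sum_bool, swapSystem, ofLex_toLex, if_true, Bool.false_eq_true, if_false,
      smul_smul, ← add_smul]
    congr 1
    ring
  · rw [randNorm]
    congr 2
    funext ω
    rw [← (toLex : ι × Bool ≃ ι ×ₗ Bool).sum_comp, Fintype.sum_prod_type, randSum]
    refine Finset.sum_congr rfl fun i _ => ?_
    simp only [Fintype.sum_bool, swapSystem, ofLex_toLex, if_true, Bool.false_eq_true, if_false,
      smul_smul, ← add_smul]
    congr 1
    ring

end

/-! ### The standard and the one-third shifted dyadic system -/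

namespace DyadicInterval

/-- The sign `(-1) ^ j` as an integer. -/
def levelSign (j : ℤ) : ℤ := if Even j then 1 else -1

theorem levelSign_eq (j : ℤ) : levelSign j = 1 ∨ levelSign j = -1 := by
  unfold levelSign
  split_ifs <;> simp

theorem cast_levelSign (j : ℤ) : (levelSign j : ℝ) = (-1 : ℝ) ^ j := by
  unfold levelSign
  split_ifs with h
  · simp [h.neg_one_zpow]
  · simp [(Int.not_even_iff_odd.1 h).neg_one_zpow]

theorem levelSign_add_one (j : ℤ) : levelSign (j + 1) = -levelSign j := by
  unfold levelSign
  by_cases h : Even j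
  · simp [h]
  · simp [h]

theorem levelSign_sub_two_mul (j l : ℤ) : levelSign (j - 2 * l) = levelSign j := by
  have : Even (j - 2 * l) ↔ Even j := by simp [Int.even_sub]
  simp [levelSign, this]

/-- The position `k` of the interval of level `j` of the standard (`δ = 0`) or of the one-third
shifted (`δ = 1`) dyadic system that contains `x`. -/
def gridIndex (δ : Fin 2) (j : ℤ) (x : ℝ) : ℤ :=
  ⌊(2 : ℝ) ^ j * x - ((δ : ℕ) : ℝ) * levelSign j / 3⌋

/-- The `n`-th interval of level `j` of the system `δ`. -/
def gridCell (δ : Fin 2) (j n : ℤ) : Set ℝ := gridIndex δ j ⁻¹' {n}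

theorem gridCell_eq_Ico (δ : Fin 2) (j n : ℤ) :
    gridCell δ j n = Set.Ico ((2 : ℝ) ^ (-j) * (n + ((δ : ℕ) : ℝ) * levelSign j / 3))
      ((2 : ℝ) ^ (-j) * (n + ((δ : ℕ) : ℝ) * levelSign j / 3) + (2 : ℝ) ^ (-j)) := by
  ext x
  have h2 : (0 : ℝ) < 2 ^ j := by positivity
  have e : ∀ w : ℝ, (2 : ℝ) ^ (-j) * w + 2 ^ (-j) = (2 ^ j)⁻¹ * (w + 1) := by
    intro w
    rw [zpow_neg]
    ring
  simp only [gridCell, Set.mem_preimage, Set.mem_singleton_iff, gridIndex, Int.floor_eq_iff,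
    Set.mem_Ico, e]
  simp only [zpow_neg, inv_mul_le_iff₀ h2, lt_inv_mul_iff₀ h2]
  constructor <;> rintro ⟨h1, h2⟩ <;> constructor <;> linarith

theorem measurableSet_gridCell (δ : Fin 2) (j n : ℤ) : MeasurableSet (gridCell δ j n) := by
  rw [gridCell_eq_Ico]
  exact measurableSet_Ico

theorem volume_gridCell (δ : Fin 2) (j n : ℤ) :
    volume (gridCell δ j n) = ENNReal.ofReal ((2 : ℝ) ^ (-j)) := by
  rw [gridCell_eq_Ico, Real.volume_Ico, add_sub_cancel_left]

theorem gridCell_nonempty (δ : Fin 2) (j n : ℤ) : (gridCell δ j n).Nonempty := by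
  rw [gridCell_eq_Ico, Set.nonempty_Ico]
  simp only [lt_add_iff_pos_right]
  positivity

theorem disjoint_gridCell (δ : Fin 2) (j : ℤ) {n n' : ℤ} (h : n ≠ n') :
    Disjoint (gridCell δ j n) (gridCell δ j n') :=
  Disjoint.preimage _ (Set.disjoint_singleton.2 h)

theorem sigmaSet_eq (δ : Fin 2) (I : DyadicInterval) :
    I.sigmaSet δ = gridCell δ I.scale I.pos := by
  rw [gridCell_eq_Ico, sigmaSet, toSet, Set.image_add_const_Ico, left, oneThird, length,
    ← cast_levelSign]
  congr 1 <;> ring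

theorem tauSigmaSet_eq (m : ℤ) (δ : Fin 2) (I : DyadicInterval) :
    I.tauSigmaSet m δ = gridCell δ I.scale (I.pos + m) := by
  rw [tauSigmaSet, sigmaSet_eq, gridCell_eq_Ico, gridCell_eq_Ico, Set.image_add_const_Ico, length]
  push_cast
  congr 1 <;> ring

theorem gridIndex_eq_ediv (δ : Fin 2) (j : ℤ) (x : ℝ) :
    gridIndex δ j x = (gridIndex δ (j + 1) x - ((δ : ℕ) : ℤ) * levelSign j) / 2 := by
  have := Int.floor_div_natCast ((2 : ℝ) ^ (j + 1) * x -
    ((δ : ℕ) : ℝ) * levelSign (j + 1) / 3 - ((((δ : ℕ) : ℤ) * levelSign j : ℤ) : ℝ)) 2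
  rw [Int.floor_sub_intCast] at this
  refine Eq.trans ?_ this
  rw [gridIndex, levelSign_add_one, zpow_add₀ (by norm_num : (2 : ℝ) ≠ 0)]
  congr 1
  push_cast
  rw [zpow_one]
  ring

/-- Between levels that differ by the even number `2 l`, the position in the coarser system is
obtained by a translation and a division; the translation accounts for the one-third shift, since
`4 ^ l / 3 = c + 1 / 3`. -/
theorem gridIndex_sub_two_mul (δ : Fin 2) (j : ℤ) (l : ℕ) (c : ℤ) (hc : (4 : ℤ) ^ l = 3 * c + 1)
    (x : ℝ) : gridIndex δ (j - 2 * l) x =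
      (gridIndex δ j x - ((δ : ℕ) : ℤ) * levelSign j * c) / 4 ^ l := by
  have := Int.floor_div_natCast ((2 : ℝ) ^ j * x -
    ((δ : ℕ) : ℝ) * levelSign j / 3 - ((((δ : ℕ) : ℤ) * levelSign j * c : ℤ) : ℝ)) (4 ^ l)
  rw [Int.floor_sub_intCast] at this
  have hM : ((4 : ℤ) ^ l) = ((4 ^ l : ℕ) : ℤ) := by push_cast; rfl
  have hc' : (4 : ℝ) ^ l = 3 * c + 1 := by exact_mod_cast hc
  rw [gridIndex, gridIndex, hM, ← this, levelSign_sub_two_mul]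
  have h2 : (2 : ℝ) ^ (j - 2 * (l : ℤ)) = 2 ^ j / 4 ^ l := by
    rw [zpow_sub₀ (by norm_num : (2 : ℝ) ≠ 0), zpow_mul]
    norm_num
  congr 1
  push_cast
  rw [h2, eq_div_iff (by positivity)]
  have : (2 : ℝ) ^ j / 4 ^ l * x * 4 ^ l = 2 ^ j * x := by
    field_simp
  rw [sub_mul, this, hc']
  ring

theorem gridIndex_congr_of_le (δ : Fin 2) {j j' : ℤ} (hj : j ≤ j') {x y : ℝ}
    (h : gridIndex δ j' x = gridIndex δ j' y) : gridIndex δ j x = gridIndex δ j y := by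
  induction j', hj using Int.leInduction with
  | base => exact h
  | succ n _ ih => exact ih (by rw [gridIndex_eq_ediv, gridIndex_eq_ediv δ n y, h])

/-- The left (`b = 0`) and right (`b = 1`) half of `σ^δ(I)`, an interval of the next level of the
system `δ`. The sign accounts for the opposite directions of the shift on the two levels. -/
def halfCell (δ : Fin 2) (b : ℤ) (I : DyadicInterval) : Set ℝ :=
  gridCell δ (I.scale + 1) (2 * I.pos + ((δ : ℕ) : ℤ) * levelSign I.scale + b)

theorem halfCell_union (δ : Fin 2) (I : DyadicInterval) :
    halfCell δ 0 I ∪ halfCell δ 1 I = I.sigmaSet δ := by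
  ext x
  have := gridIndex_eq_ediv δ I.scale x
  simp only [halfCell, sigmaSet_eq, gridCell, Set.mem_union, Set.mem_preimage,
    Set.mem_singleton_iff]
  generalize ((δ : ℕ) : ℤ) * levelSign I.scale = t at *
  omega

theorem disjoint_halfCell (δ : Fin 2) (I : DyadicInterval) {b b' : ℤ} (h : b ≠ b') :
    Disjoint (halfCell δ b I) (halfCell δ b' I) :=
  disjoint_gridCell _ _ (by simpa using h)

/-- The half of `σ^1(I)` that lies in `I` is the left one for even levels and the right one for odd
levels. -/
theorem halfCell_one_subset (I : DyadicInterval) :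
    halfCell 1 (if levelSign I.scale = 1 then 0 else 1) I ⊆ I.sigmaSet 0 := by
  intro x
  simp only [halfCell, sigmaSet_eq, gridCell, gridIndex, Set.mem_preimage, Set.mem_singleton_iff,
    Int.floor_eq_iff, levelSign_add_one, zpow_add₀ (by norm_num : (2 : ℝ) ≠ 0), zpow_one,
    mul_right_comm _ (2 : ℝ) x]
  generalize (2 : ℝ) ^ I.scale * x = y
  rcases levelSign_eq I.scale with h | h <;> simp only [h] <;> norm_num <;>
    intro h1 h2 <;> constructor <;> linarith

/-- The half of `I` that lies in `σ^1(I)` is the right one for even levels and the left one for odd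
levels. -/
theorem halfCell_zero_subset (I : DyadicInterval) :
    halfCell 0 (if levelSign I.scale = 1 then 1 else 0) I ⊆ I.sigmaSet 1 := by
  intro x
  simp only [halfCell, sigmaSet_eq, gridCell, gridIndex, Set.mem_preimage, Set.mem_singleton_iff,
    Int.floor_eq_iff, levelSign_add_one, zpow_add₀ (by norm_num : (2 : ℝ) ≠ 0), zpow_one,
    mul_right_comm _ (2 : ℝ) x]
  generalize (2 : ℝ) ^ I.scale * x = y
  rcases levelSign_eq I.scale with h | h <;> simp only [h] <;> norm_num <;>
    intro h1 h2 <;> constructor <;> linarith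

theorem halfCell_subset (δ : Fin 2) {b : ℤ} (hb : b = 0 ∨ b = 1) (I : DyadicInterval) :
    halfCell δ b I ⊆ I.sigmaSet δ := by
  rw [← halfCell_union]
  rcases hb with rfl | rfl
  · exact Set.subset_union_left
  · exact Set.subset_union_right

theorem sigmaSet_nonempty (δ : Fin 2) (I : DyadicInterval) : (I.sigmaSet δ).Nonempty := by
  rw [sigmaSet_eq]; exact gridCell_nonempty _ _ _

/-! ### Splitting the dyadic intervals into nested classes -/

/-- Two integers at distance less than a quarter of a block length `M = 3 c + 1`, if separated by
the standard blocks of length `M`, lie in one block after translation by `± c`. -/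
theorem ediv_eq_ediv_of_shift {M c k m s : ℤ} (hM : M = 3 * c + 1) (hm : 0 ≤ m)
    (hmM : 4 * (m + 1) ≤ M) (hs : s = 1 ∨ s = -1) (h : k / M ≠ (k + m) / M) :
    (k - s * c) / M = (k + m - s * c) / M := by
  have hM0 : 0 < M := by omega
  obtain ⟨q, r, hr0, hr1, rfl⟩ : ∃ q r, 0 ≤ r ∧ r < M ∧ k = r + M * q :=
    ⟨k / M, k % M, Int.emod_nonneg _ hM0.ne', Int.emod_lt_of_pos _ hM0,
      (Int.emod_add_mul_ediv k M).symm⟩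
  have hdiv : ∀ t, 0 ≤ t → t < M → ∀ u, (t + M * u) / M = u := by
    intro t h1 h2 u
    rw [Int.add_mul_ediv_left _ _ hM0.ne', Int.ediv_eq_zero_of_lt h1 h2, zero_add]
  have hrm : M ≤ r + m := by
    by_contra hlt
    refine h ?_
    rw [hdiv r hr0 hr1, show r + M * q + m = (r + m) + M * q by ring,
      hdiv (r + m) (by omega) (by omega)]
  rcases hs with rfl | rfl
  · rw [show r + M * q - 1 * c = (r - c) + M * q by ring,
      show r + M * q + m - 1 * c = (r + m - c) + M * q by ring,
      hdiv _ (by omega) (by omega), hdiv _ (by omega) (by omega)]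
  · rw [show r + M * q - -1 * c = (r + c - M) + M * (q + 1) by ring,
      show r + M * q + m - -1 * c = (r + m + c - M) + M * (q + 1) by ring,
      hdiv _ (by omega) (by omega), hdiv _ (by omega) (by omega)]

/-- For `M = 4 ^ l = 3 c + 1`: the sets `σ^δ(I)` and `τ_m(σ^δ(I))` lie in one interval of the
system `δ` that is `M` times as long as `I`, in terms of positions as in
`gridIndex_sub_two_mul`. -/
def ShiftFits (m M c : ℤ) (δ : Fin 2) (I : DyadicInterval) : Prop :=
  (I.pos - ((δ : ℕ) : ℤ) * levelSign I.scale * c) / M =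
    (I.pos + m - ((δ : ℕ) : ℤ) * levelSign I.scale * c) / M

theorem shiftFits_zero_or_one {m M c : ℤ} (hM : M = 3 * c + 1) (hmM : 4 * (|m| + 1) ≤ M)
    (I : DyadicInterval) : ShiftFits m M c 0 I ∨ ShiftFits m M c 1 I := by
  unfold ShiftFits
  by_cases h : I.pos / M = (I.pos + m) / M
  · left; simpa using h
  right
  simp only [Fin.val_one, Nat.cast_one, one_mul]
  rcases le_total 0 m with h0 | h0
  · rw [abs_of_nonneg h0] at hmM
    exact ediv_eq_ediv_of_shift hM h0 hmM (levelSign_eq _) h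
  · rw [abs_of_nonpos h0] at hmM
    have := ediv_eq_ediv_of_shift (k := I.pos + m) hM (neg_nonneg.2 h0) hmM (levelSign_eq I.scale)
      (by simpa using fun h' => h h'.symm)
    simpa using this.symm

/-- The residue of the level modulo `L`, combined with the parity of the position in steps of
`|m|`; the latter differs for `I` and `τ_m(I)`. -/
def shiftClass (m L : ℤ) (I : DyadicInterval) : ℤ :=
  2 * (I.scale % L) + I.pos / |m| % 2

theorem shiftClass_eq {m L : ℤ} {I I' : DyadicInterval}
    (h : shiftClass m L I = shiftClass m L I') :
    I.scale % L = I'.scale % L ∧ I.pos / |m| % 2 = I'.pos / |m| % 2 := by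
  unfold shiftClass at h
  omega

theorem ediv_abs_emod_two_ne {m k : ℤ} (hm : m ≠ 0) : (k + m) / |m| % 2 ≠ k / |m| % 2 := by
  have h0 : |m| ≠ 0 := abs_ne_zero.2 hm
  rcases abs_choice m with h | h
  · have : (k + m) / |m| = k / |m| + 1 := by
      conv_lhs => rw [show k + m = k + 1 * |m| by rw [h, one_mul]]
      rw [Int.add_mul_ediv_right _ _ h0]
    omega
  · have : (k + m) / |m| = k / |m| + -1 := by
      conv_lhs => rw [show k + m = k + -1 * |m| by rw [h]; ring]
      rw [Int.add_mul_ediv_right _ _ h0]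
    omega

/-- The sets attached to `I` are the inverse images under `gridIndex` of `{k}`, `{k + m}` and
`{k, k + m}`. -/
theorem eq_preimage_gridIndex {m : ℤ} {δ : Fin 2} {I : DyadicInterval} {A : Set ℝ}
    (hA : A = I.sigmaSet δ ∨ A = I.tauSigmaSet m δ ∨ A = I.sigmaSet δ ∪ I.tauSigmaSet m δ) :
    ∃ V : Set ℤ, (V = {I.pos} ∨ V = {I.pos + m} ∨ V = {I.pos, I.pos + m}) ∧
      A = gridIndex δ I.scale ⁻¹' V := by
  rw [sigmaSet_eq, tauSigmaSet_eq] at hA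
  rcases hA with rfl | rfl | rfl
  · exact ⟨_, Or.inl rfl, rfl⟩
  · exact ⟨_, Or.inr (Or.inl rfl), rfl⟩
  · exact ⟨_, Or.inr (Or.inr rfl), rfl⟩

theorem isNested_of_shiftFits {m c : ℤ} {l : ℕ} (hc : (4 : ℤ) ^ l = 3 * c + 1)
    (δ : Fin 2) {𝓒 : Set DyadicInterval}
    (hfit : ∀ I ∈ 𝓒, ShiftFits m (4 ^ l) c δ I)
    (hcls : ∀ I ∈ 𝓒, ∀ I' ∈ 𝓒, shiftClass m (2 * l) I = shiftClass m (2 * l) I') :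
    IsNested {A : Set ℝ | ∃ I ∈ 𝓒,
      A = I.sigmaSet δ ∨ A = I.tauSigmaSet m δ ∨ A = I.sigmaSet δ ∪ I.tauSigmaSet m δ} := by
  -- a set attached to an interval of strictly smaller length lies in one cell of the longer one
  have hlt : ∀ I ∈ 𝓒, ∀ I' ∈ 𝓒, I.scale < I'.scale → ∀ V V' : Set ℤ,
      (V' = {I'.pos} ∨ V' = {I'.pos + m} ∨ V' = {I'.pos, I'.pos + m}) →
      gridIndex δ I'.scale ⁻¹' V' ⊆ gridIndex δ I.scale ⁻¹' V ∨
        Disjoint (gridIndex δ I.scale ⁻¹' V) (gridIndex δ I'.scale ⁻¹' V') := by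
    intro I hI I' hI' hlt V V' hV'
    have hgap : I.scale ≤ I'.scale - 2 * l := by
      have h1 : (2 * (l : ℤ)) ∣ I'.scale - I.scale :=
        Int.ModEq.dvd (shiftClass_eq (hcls I hI I' hI')).1
      have := Int.le_of_dvd (by omega) h1
      omega
    have hval : ∀ x ∈ gridIndex δ I'.scale ⁻¹' V', gridIndex δ (I'.scale - 2 * l) x =
        (I'.pos - ((δ : ℕ) : ℤ) * levelSign I'.scale * c) / 4 ^ l := by
      intro x hx
      have hfit' : _ = _ := hfit I' hI'
      rw [gridIndex_sub_two_mul δ I'.scale l c hc]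
      have : gridIndex δ I'.scale x = I'.pos ∨ gridIndex δ I'.scale x = I'.pos + m := by
        rcases hV' with rfl | rfl | rfl
        · exact Or.inl hx
        · exact Or.inr hx
        · exact hx
      rcases this with h | h
      · rw [h]
      · rw [h, ← hfit']
    by_cases hd : Disjoint (gridIndex δ I.scale ⁻¹' V) (gridIndex δ I'.scale ⁻¹' V')
    · exact Or.inr hd
    left
    obtain ⟨x, hxV, hxV'⟩ := Set.not_disjoint_iff.1 hd
    intro y hy
    have : gridIndex δ I.scale y = gridIndex δ I.scale x :=
      gridIndex_congr_of_le δ hgap ((hval y hy).trans (hval x hxV').symm)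
    rw [Set.mem_preimage, this]
    exact hxV
  rintro A ⟨I, hI, hA⟩ B ⟨I', hI', hB⟩
  obtain ⟨V, hV, rfl⟩ := eq_preimage_gridIndex hA
  obtain ⟨V', hV', rfl⟩ := eq_preimage_gridIndex hB
  rcases lt_trichotomy I.scale I'.scale with h | h | h
  · rcases hlt I hI I' hI' h V V' hV' with h | h
    · exact Or.inr (Or.inl h)
    · exact Or.inr (Or.inr h)
  · rw [← h]
    have hVV : V ⊆ V' ∨ V' ⊆ V ∨ Disjoint V V' := by
      by_cases hpos : I.pos = I'.pos
      · rw [← hpos] at hV'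
        rcases hV with rfl | rfl | rfl <;> rcases hV' with rfl | rfl | rfl <;>
          simp [Set.subset_def, eq_comm, em]
      · have hcol := (shiftClass_eq (hcls I hI I' hI')).2
        have h1 : I.pos + m ≠ I'.pos := by
          rintro h'
          rcases eq_or_ne m 0 with rfl | hm
          · exact hpos (by simpa using h')
          · rw [← h'] at hcol
            exact ediv_abs_emod_two_ne hm hcol.symm
        have h2 : I'.pos + m ≠ I.pos := by
          rintro h'
          rcases eq_or_ne m 0 with rfl | hm
          · exact hpos (by simpa using h'.symm)
          · rw [← h'] at hcol
            exact ediv_abs_emod_two_ne hm hcol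
        right; right
        rw [Set.disjoint_left]
        rcases hV with rfl | rfl | rfl <;> rcases hV' with rfl | rfl | rfl <;>
          simp only [Set.mem_singleton_iff, Set.mem_insert_iff] <;> omega
    rcases hVV with h | h | h
    · exact Or.inl (Set.preimage_mono h)
    · exact Or.inr (Or.inl (Set.preimage_mono h))
    · exact Or.inr (Or.inr (h.preimage _))
  · rcases hlt I' hI' I hI h V' V hV with h | h
    · exact Or.inl h
    · exact Or.inr (Or.inr h.symm)

end DyadicInterval

open DyadicInterval in
/-- An interval belongs to the part `δ = 0` whenever it fits, and there are `2 * (q + 1)` residues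
of levels and two parities for each `δ`. -/
theorem exists_isShiftDecomposition (m : ℤ) :
    ∃ (K : ℕ) (𝓑 : Fin 2 → Fin (K + 1) → Set DyadicInterval),
      (K : ℝ) ≤ 7 + 2 * Real.logb 2 (1 + |(m : ℝ)|) ∧ IsShiftDecomposition m K 𝓑 := by
  -- `4 ^ (q + 1)` is the least positive power of `4` that is at least `4 * (|m| + 1)`
  set q : ℕ := Nat.clog 4 (m.natAbs + 1) with hq
  have hq1 : m.natAbs + 1 ≤ 4 ^ q := Nat.le_pow_clog (by norm_num) _
  have hq2 : 4 ^ q < 4 * (m.natAbs + 1) := by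
    rcases Nat.eq_zero_or_pos q with h | h
    · rw [h]; omega
    · have := Nat.pow_pred_clog_lt_self (b := 4) (by norm_num) (x := m.natAbs + 1) (by
        by_contra hle
        have : m.natAbs + 1 = 1 := by omega
        rw [hq, this] at h
        simp at h)
      rw [← hq] at this
      obtain ⟨r, hr⟩ : ∃ r, q = r + 1 := ⟨q - 1, by omega⟩
      rw [hr] at this ⊢
      rw [pow_succ]
      simp only [Nat.pred_eq_sub_one, Nat.add_sub_cancel] at this
      omega
  obtain ⟨c, hc⟩ : ∃ c : ℤ, (4 : ℤ) ^ (q + 1) = 3 * c + 1 := by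
    have : (3 : ℤ) ∣ 4 ^ (q + 1) - 1 := by
      simpa using sub_dvd_pow_sub_pow (4 : ℤ) 1 (q + 1)
    obtain ⟨c, hc⟩ := this
    exact ⟨c, by omega⟩
  have hM : 4 * (|m| + 1) ≤ (4 : ℤ) ^ (q + 1) := by
    rw [pow_succ, Int.abs_eq_natAbs]
    have : (m.natAbs : ℤ) + 1 ≤ 4 ^ q := by exact_mod_cast hq1
    linarith
  refine ⟨4 * q + 3, fun δ i => {I | shiftClass m (2 * (q + 1 : ℕ)) I = i ∧
    (ShiftFits m (4 ^ (q + 1)) c 0 I ↔ δ = 0)}, ?_, ?_, ?_, ?_⟩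
  · have h1 : (2 : ℝ) * q ≤ 2 + Real.logb 2 (1 + |(m : ℝ)|) := by
      have h2 : (4 : ℝ) ^ q ≤ 4 * (1 + |(m : ℝ)|) := by
        have : ((4 ^ q : ℕ) : ℝ) ≤ ((4 * (m.natAbs + 1) : ℕ) : ℝ) := by exact_mod_cast hq2.le
        push_cast [Nat.cast_natAbs] at this
        rw [add_comm 1]
        exact this
      have hpos : (0 : ℝ) < 1 + |(m : ℝ)| := by positivity
      have h3 := Real.logb_le_logb_of_le (b := 2) (by norm_num) (by positivity) h2
      rw [Real.logb_mul (by norm_num) hpos.ne', Real.logb_pow] at h3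
      have h4 : Real.logb 2 4 = 2 := by
        rw [show (4 : ℝ) = 2 ^ (2 : ℕ) by norm_num, Real.logb_pow,
          Real.logb_self_eq_one (by norm_num)]
        norm_num
      rw [h4] at h3
      linarith
    push_cast
    linarith
  · rintro ⟨δ, i⟩ ⟨δ', i'⟩ hne
    rw [Set.disjoint_left]
    rintro I ⟨h1, h2⟩ ⟨h3, h4⟩
    apply hne
    have hi : i = i' := by
      rw [h1] at h3
      exact Fin.ext (by exact_mod_cast h3)
    have hδ : δ = δ' := by
      have : δ = 0 ↔ δ' = 0 := h2.symm.trans h4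
      fin_cases δ <;> fin_cases δ' <;> simp_all
    rw [hi, hδ]
  · rw [Set.eq_univ_iff_forall]
    intro I
    simp only [Set.mem_iUnion, Set.mem_ofPred_eq]
    have h1 : 0 ≤ shiftClass m (2 * (q + 1 : ℕ)) I ∧
        shiftClass m (2 * (q + 1 : ℕ)) I < 4 * q + 4 := by
      unfold shiftClass
      have := Int.emod_nonneg I.scale (b := 2 * (q + 1 : ℕ)) (by push_cast; omega)
      have := Int.emod_lt_of_pos I.scale (b := 2 * (q + 1 : ℕ)) (by push_cast; omega)
      push_cast at *
      omega
    obtain ⟨k, hk⟩ := Int.eq_ofNat_of_zero_le h1.1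
    have hk' : k < 4 * q + 3 + 1 := by omega
    by_cases hf : ShiftFits m (4 ^ (q + 1)) c 0 I
    · exact ⟨0, ⟨k, hk'⟩, hk, by simp [hf]⟩
    · exact ⟨1, ⟨k, hk'⟩, hk, by simp [hf]⟩
  · intro δ i
    refine isNested_of_shiftFits hc δ (fun I hI => ?_)
      fun I hI I' hI' => hI.1.trans hI'.1.symm
    fin_cases δ
    · exact hI.2.2 rfl
    · exact (shiftFits_zero_or_one hc hM I).resolve_left fun h => absurd (hI.2.1 h) (by simp)

/-! ### The shift on finite Haar sums -/

namespace DyadicInterval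

/-- Dyadic intervals are ordered by level, longer intervals first, and by position. -/
instance : LinearOrder DyadicInterval :=
  LinearOrder.lift' (fun I => toLex (I.scale, I.pos)) fun I I' h => by
    have h' := toLex.injective h
    exact DyadicInterval.ext (congrArg Prod.fst h') (congrArg Prod.snd h')

theorem scale_le_of_lt {I I' : DyadicInterval} (h : I < I') : I.scale ≤ I'.scale := by
  have h' : toLex (I.scale, I.pos) < toLex (I'.scale, I'.pos) := h
  rcases Prod.Lex.toLex_lt_toLex.1 h' with h' | h'
  · exact h'.le
  · exact h'.1.le

theorem halfCell_zero_eq (b : ℤ) (I : DyadicInterval) : halfCell 0 b I =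
    Set.Ico (I.left + b * (I.length / 2)) (I.left + b * (I.length / 2) + I.length / 2) := by
  have e : (2 : ℝ) ^ (-(I.scale + 1)) = I.length / 2 := by
    rw [length, neg_add, zpow_add₀ (by norm_num : (2 : ℝ) ≠ 0), zpow_neg_one, div_eq_mul_inv]
  rw [halfCell, gridCell_eq_Ico, e, left]
  push_cast
  simp only [Fin.val_zero, Nat.cast_zero, zero_mul, zero_div, add_zero]
  congr 1 <;> ring

theorem haar_eq_sub (I : DyadicInterval) (t : ℝ) :
    I.haar t = (halfCell 0 0 I).indicator 1 t - (halfCell 0 1 I).indicator 1 t := by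
  rw [haar_eq, halfCell_zero_eq, halfCell_zero_eq]
  simp only [Int.cast_zero, zero_mul, add_zero, Int.cast_one, one_mul, add_assoc, add_halves]
  rfl

theorem haar_of_mem_zero {I : DyadicInterval} {t : ℝ} (h : t ∈ halfCell 0 0 I) : I.haar t = 1 := by
  have h' := Set.disjoint_left.1 (disjoint_halfCell 0 I zero_ne_one) h
  simp [haar_eq_sub, h, h']

theorem haar_of_mem_one {I : DyadicInterval} {t : ℝ} (h : t ∈ halfCell 0 1 I) : I.haar t = -1 := by
  have h' := Set.disjoint_right.1 (disjoint_halfCell 0 I zero_ne_one) h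
  simp [haar_eq_sub, h, h']

theorem haar_of_notMem {I : DyadicInterval} {t : ℝ} (h : t ∉ I.sigmaSet 0) : I.haar t = 0 := by
  simp only [← halfCell_union, Set.mem_union, not_or] at h
  simp [haar_eq_sub, h.1, h.2]

theorem abs_haar (I : DyadicInterval) (t : ℝ) :
    |I.haar t| = |(I.sigmaSet 0).indicator (1 : ℝ → ℝ) t| := by
  by_cases h : t ∈ I.sigmaSet 0
  · rw [Set.indicator_of_mem h]
    rw [← halfCell_union] at h
    rcases h with h | h
    · rw [haar_of_mem_zero h, Pi.one_apply]
    · rw [haar_of_mem_one h, Pi.one_apply, abs_neg]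
  · rw [Set.indicator_of_notMem h, haar_of_notMem h]

theorem abs_haar_le (I : DyadicInterval) (t : ℝ) : |I.haar t| ≤ 1 := by
  rw [abs_haar]
  by_cases h : t ∈ I.sigmaSet 0 <;> simp [h]

theorem measurableSet_sigmaSet (δ : Fin 2) (I : DyadicInterval) :
    MeasurableSet (I.sigmaSet δ) := by
  rw [sigmaSet_eq]
  exact measurableSet_gridCell _ _ _

theorem volume_sigmaSet (δ : Fin 2) (I : DyadicInterval) :
    volume (I.sigmaSet δ) = ENNReal.ofReal I.length := by
  rw [sigmaSet_eq, volume_gridCell, length]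

theorem measurableSet_halfCell (δ : Fin 2) (b : ℤ) (I : DyadicInterval) :
    MeasurableSet (halfCell δ b I) := measurableSet_gridCell _ _ _

theorem measurable_haar (I : DyadicInterval) : Measurable I.haar := by
  have : I.haar = fun t => (halfCell 0 0 I).indicator 1 t - (halfCell 0 1 I).indicator 1 t :=
    funext I.haar_eq_sub
  rw [this]
  exact (measurable_one.indicator (measurableSet_halfCell _ _ _)).sub
    (measurable_one.indicator (measurableSet_halfCell _ _ _))

theorem volume_halfCell (δ : Fin 2) (b b' : ℤ) (I : DyadicInterval) :
    volume (halfCell δ b I) = volume (halfCell δ b' I) := by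
  rw [halfCell, halfCell, volume_gridCell, volume_gridCell]

theorem volume_halfCell_ne_top (δ : Fin 2) (b : ℤ) (I : DyadicInterval) :
    volume (halfCell δ b I) ≠ ∞ := by
  rw [halfCell, volume_gridCell]
  exact ENNReal.ofReal_ne_top

theorem integral_haar (I : DyadicInterval) : ∫ t, I.haar t = 0 := by
  have hi : ∀ b, Integrable ((halfCell 0 b I).indicator (1 : ℝ → ℝ)) := fun b =>
    (integrable_indicator_iff (measurableSet_halfCell _ _ _)).2
      (integrableOn_const (volume_halfCell_ne_top _ _ _))
  simp only [haar_eq_sub]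
  rw [integral_sub (hi 0) (hi 1), integral_indicator_one (measurableSet_halfCell _ _ _),
    integral_indicator_one (measurableSet_halfCell _ _ _), measureReal_def, measureReal_def,
    volume_halfCell 0 0 1, sub_self]

/-- The halves of one interval of the system `δ` do not separate points of another interval that
is not longer. -/
theorem mem_halfCell_iff {δ : Fin 2} {I I' : DyadicInterval} (hne : I' ≠ I)
    (hs : I'.scale ≤ I.scale) {x y : ℝ} (hx : x ∈ I.sigmaSet δ) (hy : y ∈ I.sigmaSet δ) {b : ℤ}
    (hb : b = 0 ∨ b = 1) : x ∈ halfCell δ b I' ↔ y ∈ halfCell δ b I' := by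
  have hx' := hx
  have hy' := hy
  rw [sigmaSet_eq] at hx hy
  rcases hs.lt_or_eq with hs | hs
  · have := gridIndex_congr_of_le δ (Int.add_one_le_of_lt hs) (Eq.trans hx (Eq.symm hy))
    rw [halfCell, gridCell, Set.mem_preimage, Set.mem_preimage, this]
  · have hd : Disjoint (I.sigmaSet δ) (I'.sigmaSet δ) := by
      rw [sigmaSet_eq, sigmaSet_eq, hs]
      exact disjoint_gridCell _ _ fun h => hne (DyadicInterval.ext hs h.symm)
    have key : ∀ z ∈ I.sigmaSet δ, z ∉ halfCell δ b I' := fun z hz hz' =>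
      Set.disjoint_left.1 hd hz (halfCell_subset δ hb I' hz')
    exact iff_of_false (key x hx') (key y hy')

theorem gridCell_subset_gridCell {δ : Fin 2} {j j' n n' : ℤ}
    (h : gridCell δ j n ⊆ gridCell δ j' n') : j' ≤ j := by
  have := measure_mono (μ := volume) h
  rw [volume_gridCell, volume_gridCell, ENNReal.ofReal_le_ofReal_iff (by positivity),
    zpow_le_zpow_iff_right₀ (by norm_num)] at this
  omega

/-- In a nested class, the sets `J'` and `τ_m(J')` do not separate points of `J ∪ τ_m(J)` if `J` is
not longer than `J'`. -/
theorem mem_sigmaSet_iff_of_isNested {m : ℤ} {δ : Fin 2} {𝓒 : Set DyadicInterval}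
    (h𝓒 : IsNested {A : Set ℝ | ∃ I ∈ 𝓒,
      A = I.sigmaSet δ ∨ A = I.tauSigmaSet m δ ∨ A = I.sigmaSet δ ∪ I.tauSigmaSet m δ})
    {I I' : DyadicInterval} (hI : I ∈ 𝓒) (hI' : I' ∈ 𝓒) (hne : I' ≠ I)
    (hs : I'.scale ≤ I.scale) {x y : ℝ} (hx : x ∈ I.sigmaSet δ ∪ I.tauSigmaSet m δ)
    (hy : y ∈ I.sigmaSet δ ∪ I.tauSigmaSet m δ) :
    (x ∈ I'.sigmaSet δ ↔ y ∈ I'.sigmaSet δ) ∧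
      (x ∈ I'.tauSigmaSet m δ ↔ y ∈ I'.tauSigmaSet m δ) := by
  have hE := h𝓒 _ ⟨I', hI', Or.inr (Or.inr rfl)⟩ _ ⟨I, hI, Or.inr (Or.inr rfl)⟩
  have h1 := h𝓒 _ ⟨I', hI', Or.inl rfl⟩ _ ⟨I, hI, Or.inr (Or.inr rfl)⟩
  have h2 := h𝓒 _ ⟨I', hI', Or.inr (Or.inl rfl)⟩ _ ⟨I, hI, Or.inr (Or.inr rfl)⟩
  simp only [sigmaSet_eq, tauSigmaSet_eq] at hx hy hE h1 h2 ⊢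
  have key : ∀ n, n = I'.pos ∨ n = I'.pos + m →
      (gridCell δ I'.scale n ⊆ gridCell δ I.scale I.pos ∪ gridCell δ I.scale (I.pos + m) ∨
      gridCell δ I.scale I.pos ∪ gridCell δ I.scale (I.pos + m) ⊆ gridCell δ I'.scale n ∨
      Disjoint (gridCell δ I'.scale n)
        (gridCell δ I.scale I.pos ∪ gridCell δ I.scale (I.pos + m))) →
      ∀ x ∈ gridCell δ I.scale I.pos ∪ gridCell δ I.scale (I.pos + m),
      ∀ y ∈ gridCell δ I.scale I.pos ∪ gridCell δ I.scale (I.pos + m),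
      x ∈ gridCell δ I'.scale n → y ∈ gridCell δ I'.scale n := by
    intro n hn hnest x hx y hy hxn
    rcases hnest with hsub | hsub | hd
    · by_contra hyn
      -- one of the two cells of `I` lies in the cell `n`, the other one is disjoint from it
      have hcell : ∀ z ∈ gridCell δ I'.scale n,
          gridIndex δ I.scale z = gridIndex δ I.scale x := by
        intro z hz
        have hxy : gridIndex δ I.scale x ≠ gridIndex δ I.scale y := fun h =>
          hyn (by
            have := gridIndex_congr_of_le δ hs h
            rw [gridCell, Set.mem_preimage, ← this]
            exact hxn)
        have hzy : gridIndex δ I.scale z ≠ gridIndex δ I.scale y := fun h =>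
          hyn (by
            have := gridIndex_congr_of_le δ hs h
            rw [gridCell, Set.mem_preimage, ← this]
            exact hz)
        have hx' : gridIndex δ I.scale x = I.pos ∨ gridIndex δ I.scale x = I.pos + m := hx
        have hy' : gridIndex δ I.scale y = I.pos ∨ gridIndex δ I.scale y = I.pos + m := hy
        have hz' : gridIndex δ I.scale z = I.pos ∨ gridIndex δ I.scale z = I.pos + m := hsub hz
        omega
      have hsc : I.scale = I'.scale :=
        le_antisymm
          (gridCell_subset_gridCell (δ := δ) (n := n) (n' := gridIndex δ I.scale x) hcell) hs
      have hpos : I'.pos ≠ I.pos := fun h => hne (DyadicInterval.ext hsc.symm h)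
      rw [hsc] at hE hx
      have hxn' : gridIndex δ I'.scale x = n := hxn
      have hx' : gridIndex δ I'.scale x = I.pos ∨ gridIndex δ I'.scale x = I.pos + m := hx
      have hun : ∀ a b c d : ℤ, gridCell δ I'.scale a ∪ gridCell δ I'.scale b ⊆
          gridCell δ I'.scale c ∪ gridCell δ I'.scale d → (a = c ∨ a = d) ∧ (b = c ∨ b = d) := by
        intro a b c d hsub
        obtain ⟨u, hu⟩ := gridCell_nonempty δ I'.scale a
        obtain ⟨v, hv⟩ := gridCell_nonempty δ I'.scale b
        have hu' : gridIndex δ I'.scale u = c ∨ gridIndex δ I'.scale u = d := hsub (Or.inl hu)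
        have hv' : gridIndex δ I'.scale v = c ∨ gridIndex δ I'.scale v = d := hsub (Or.inr hv)
        rw [show gridIndex δ I'.scale u = a from hu] at hu'
        rw [show gridIndex δ I'.scale v = b from hv] at hv'
        exact ⟨hu', hv'⟩
      rcases hE with hE | hE | hE
      · have := hun _ _ _ _ hE
        omega
      · have := hun _ _ _ _ hE
        omega
      · rw [Set.disjoint_left] at hE
        refine hE (a := x) ?_ hx
        rcases hn with rfl | rfl
        · exact Or.inl hxn
        · exact Or.inr hxn
    · exact hsub hy
    · exact absurd hx (Set.disjoint_left.1 hd hxn)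
  exact ⟨⟨key _ (Or.inl rfl) h1 x hx y hy, key _ (Or.inl rfl) h1 y hy x hx⟩,
    ⟨key _ (Or.inr rfl) h2 x hx y hy, key _ (Or.inr rfl) h2 y hy x hx⟩⟩

theorem sigmaSet_shift (m : ℤ) (δ : Fin 2) (I : DyadicInterval) :
    (I.shift m).sigmaSet δ = I.tauSigmaSet m δ := by
  rw [sigmaSet_eq, tauSigmaSet_eq]
  rfl

theorem shift_injective (m : ℤ) : Function.Injective (shift m) := by
  intro I I' h
  have h1 := congrArg scale h
  have h2 := congrArg pos h
  simp only [shift, add_left_inj] at h1 h2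
  exact DyadicInterval.ext h1 h2

theorem shift_zero (I : DyadicInterval) : I.shift 0 = I := by
  simp [shift]

section

variable {ι : Type} [LinearOrder ι] {ψ : ι → DyadicInterval}

theorem isDifferenceSystem_haar (hinj : Function.Injective ψ)
    (hs : ∀ i, ∀ j < i, (ψ j).scale ≤ (ψ i).scale) :
    IsDifferenceSystem (volume : Measure ℝ) fun i => (ψ i).haar := by
  intro i S hS hsat
  have hval : ∀ j < i, ∀ x ∈ (ψ i).sigmaSet 0, ∀ y ∈ (ψ i).sigmaSet 0,
      (ψ j).haar x = (ψ j).haar y := by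
    intro j hj x hx y hy
    have hne : ψ j ≠ ψ i := fun h => hj.ne (hinj h)
    classical
    simp only [haar_eq_sub, Set.indicator_apply, Pi.one_apply,
      mem_halfCell_iff hne (hs i j hj) hx hy (Or.inl rfl),
      mem_halfCell_iff hne (hs i j hj) hx hy (Or.inr rfl)]
  rw [← integral_indicator hS]
  by_cases hex : ∃ x ∈ (ψ i).sigmaSet 0, x ∈ S
  · obtain ⟨x, hx, hxS⟩ := hex
    have : S.indicator (ψ i).haar = (ψ i).haar := by
      refine Set.indicator_eq_self.2 fun y hy => ?_
      have hy' : y ∈ (ψ i).sigmaSet 0 := by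
        by_contra h
        exact hy (haar_of_notMem h)
      exact hsat x y (fun j hj => hval j hj x hx y hy') hxS
    rw [this, integral_haar]
  · have : S.indicator (ψ i).haar = 0 := by
      funext y
      by_cases hy : y ∈ S
      · rw [Set.indicator_of_mem hy]
        exact haar_of_notMem fun h => hex ⟨y, h, hy⟩
      · exact Set.indicator_of_notMem hy _
    rw [this]
    simp

variable [Fintype ι] {X : Type*} [NormedAddCommGroup X] [NormedSpace ℝ X] [CompleteSpace X]
  {p : ℝ≥0∞} {β : ℝ}

/-- Unconditionality of the Haar system. -/
theorem eLpNorm_haar_sign_le (hβ : UMDBound p X β) (hp : p ≠ ∞) (hinj : Function.Injective ψ)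
    (hs : ∀ i, ∀ j < i, (ψ j).scale ≤ (ψ i).scale) (a : ι → X) (ε : ι → ℝ)
    (hε : ∀ i, ε i = 1 ∨ ε i = -1) :
    eLpNorm (fun t => ∑ i, ε i • (ψ i).haar t • a i) p volume ≤
      ENNReal.ofReal β * eLpNorm (fun t => ∑ i, (ψ i).haar t • a i) p volume := by
  refine hβ.transform hp volume (fun i => (ψ i).haar) (fun i => measurable_haar _)
    (fun i t => abs_haar_le _ t) (fun i => ?_) (isDifferenceSystem_haar hinj hs) a ε hε
  refine lt_of_le_of_lt (measure_mono (t := (ψ i).sigmaSet 0) fun t ht => ?_)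
    (volume_sigmaSet 0 (ψ i) ▸ ENNReal.ofReal_lt_top)
  by_contra h
  exact ht (haar_of_notMem h)

theorem measurable_indicator_sigmaSet (δ : Fin 2) (I : DyadicInterval) :
    Measurable ((I.sigmaSet δ).indicator (1 : ℝ → ℝ)) :=
  measurable_one.indicator (measurableSet_sigmaSet δ I)

/-- The sum is comparable with its randomization, in which `|h_I| = 1_I` may replace `h_I`; the
reverse inequality is `eLpNorm_haar_le_randNorm_sigmaSet`. -/
theorem randNorm_sigmaSet_le_eLpNorm_haar [Fact (1 ≤ p)] (hβ : UMDBound p X β) (hp : p ≠ ∞)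
    (hinj : Function.Injective ψ) (hs : ∀ i, ∀ j < i, (ψ j).scale ≤ (ψ i).scale) (a : ι → X) :
    randNorm p (fun i => ((ψ i).sigmaSet 0).indicator 1) a ≤
      ENNReal.ofReal β * eLpNorm (fun t => ∑ i, (ψ i).haar t • a i) p volume := by
  have h0 : p ≠ 0 := (one_pos.trans_le (Fact.out : 1 ≤ p)).ne'
  rw [← randNorm_congr_abs h0 hp (fun i => measurable_indicator_sigmaSet 0 (ψ i))
    (fun i => measurable_haar (ψ i)) fun i t => abs_haar _ t]
  exact randNorm_le h0 hp (fun i => measurable_haar (ψ i)) a fun ε =>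
    eLpNorm_haar_sign_le hβ hp hinj hs a _ fun i => boolSign_eq _

theorem eLpNorm_haar_le_randNorm_sigmaSet [Fact (1 ≤ p)] (hβ : UMDBound p X β) (hp : p ≠ ∞)
    (hinj : Function.Injective ψ) (hs : ∀ i, ∀ j < i, (ψ j).scale ≤ (ψ i).scale) (a : ι → X) :
    eLpNorm (fun t => ∑ i, (ψ i).haar t • a i) p volume ≤
      ENNReal.ofReal β * randNorm p (fun i => ((ψ i).sigmaSet 0).indicator 1) a := by
  have h0 : p ≠ 0 := (one_pos.trans_le (Fact.out : 1 ≤ p)).ne'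
  rw [← randNorm_congr_abs h0 hp (fun i => measurable_indicator_sigmaSet 0 (ψ i))
    (fun i => measurable_haar (ψ i)) fun i t => abs_haar _ t]
  have key : ∀ ε : ι → Bool, eLpNorm (fun t => ∑ i, (ψ i).haar t • a i) p volume ≤
      ENNReal.ofReal β *
        eLpNorm (fun t => ∑ i, boolSign (ε i) • (ψ i).haar t • a i) p volume := by
    intro ε
    have := eLpNorm_haar_sign_le hβ hp hinj hs (fun i => boolSign (ε i) • a i)
      (fun i => boolSign (ε i)) fun i => boolSign_eq _
    have e : ∀ (i : ι) (t : ℝ), boolSign (ε i) • (ψ i).haar t • boolSign (ε i) • a i =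
        (ψ i).haar t • a i := by
      intro i t
      rw [smul_comm ((ψ i).haar t), smul_smul, boolSign_mul_self, one_smul]
    simp only [e] at this
    simpa only [smul_comm (boolSign _)] using this
  rcases eq_or_ne (ENNReal.ofReal β) 0 with hb | hb
  · have := key fun _ => true
    simp only [hb, zero_mul] at this ⊢
    exact this
  · rw [← ENNReal.div_le_iff' hb ENNReal.ofReal_ne_top]
    exact le_randNorm h0 hp (fun i => measurable_haar (ψ i)) a fun ε =>
      (ENNReal.div_le_iff' hb ENNReal.ofReal_ne_top).2 (key ε)

/-- In a randomized sum, a half of an interval may be replaced by the whole interval. -/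
theorem randNorm_sigmaSet_le_halfCell [Fact (1 ≤ p)] (hβ : UMDBound p X β) (hp : p ≠ ∞)
    (hinj : Function.Injective ψ) (hs : ∀ i, ∀ j < i, (ψ j).scale ≤ (ψ i).scale) (δ : Fin 2)
    (b : ι → ℤ) (hb : ∀ i, b i = 0 ∨ b i = 1) (a : ι → X) :
    randNorm p (fun i => ((ψ i).sigmaSet δ).indicator 1) a ≤
      (1 + ENNReal.ofReal β) * randNorm p (fun i => (halfCell δ (b i) (ψ i)).indicator 1) a := by
  have hb' : ∀ i, 1 - b i = 0 ∨ 1 - b i = 1 := fun i => by have := hb i; omega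
  have hbb : ∀ i, b i ≠ 1 - b i := fun i => by have := hb i; omega
  have hunion : ∀ i, halfCell δ (b i) (ψ i) ∪ halfCell δ (1 - b i) (ψ i) = (ψ i).sigmaSet δ := by
    intro i
    rw [← halfCell_union]
    rcases hb i with h | h
    · simp [h]
    · simp [h, Set.union_comm]
  have hswap := hβ.randNorm_swap hp (A := fun i => halfCell δ (b i) (ψ i))
    (B := fun i => halfCell δ (1 - b i) (ψ i)) (fun i => measurableSet_halfCell _ _ _)
    (fun i => measurableSet_halfCell _ _ _) (fun i => volume_halfCell_ne_top _ _ _)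
    (fun i => volume_halfCell _ _ _ _) (fun i => disjoint_halfCell δ (ψ i) (hbb i))
    (by
      intro i j hj x hx y hy
      rw [hunion] at hx hy
      have hne : ψ j ≠ ψ i := fun h => hj.ne (hinj h)
      exact ⟨mem_halfCell_iff hne (hs i j hj) hx hy (hb j),
        mem_halfCell_iff hne (hs i j hj) hx hy (hb' j)⟩) a
  have hadd := randNorm_add_le (p := p)
    (fun i => measurable_one.indicator (measurableSet_halfCell δ (b i) (ψ i)) :
      ∀ i, Measurable ((halfCell δ (b i) (ψ i)).indicator (1 : ℝ → ℝ)))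
    (fun i => measurable_one.indicator (measurableSet_halfCell δ (1 - b i) (ψ i)) :
      ∀ i, Measurable ((halfCell δ (1 - b i) (ψ i)).indicator (1 : ℝ → ℝ))) a
  have e : (fun i => ((ψ i).sigmaSet δ).indicator (1 : ℝ → ℝ)) = fun i t =>
      (halfCell δ (b i) (ψ i)).indicator (1 : ℝ → ℝ) t +
        (halfCell δ (1 - b i) (ψ i)).indicator (1 : ℝ → ℝ) t := by
    funext i t
    rw [← hunion, Set.indicator_union_of_disjoint (disjoint_halfCell δ (ψ i) (hbb i))]
  rw [e, add_mul, one_mul]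
  exact hadd.trans (add_le_add le_rfl hswap)

/-- In a randomized sum over a nested class, `J` may be replaced by `τ_m(J)`. -/
theorem randNorm_tauSigmaSet_le (hβ : UMDBound p X β) (hp : p ≠ ∞) {m : ℤ} (hm : m ≠ 0)
    {δ : Fin 2} {𝓒 : Set DyadicInterval}
    (h𝓒 : IsNested {A : Set ℝ | ∃ I ∈ 𝓒,
      A = I.sigmaSet δ ∨ A = I.tauSigmaSet m δ ∨ A = I.sigmaSet δ ∪ I.tauSigmaSet m δ})
    (hmem : ∀ i, ψ i ∈ 𝓒)
    (hinj : Function.Injective ψ) (hs : ∀ i, ∀ j < i, (ψ j).scale ≤ (ψ i).scale) (a : ι → X) :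
    randNorm p (fun i => ((ψ i).tauSigmaSet m δ).indicator 1) a ≤
      ENNReal.ofReal β * randNorm p (fun i => ((ψ i).sigmaSet δ).indicator 1) a := by
  refine hβ.randNorm_swap hp (fun i => measurableSet_sigmaSet δ (ψ i))
    (fun i => sigmaSet_shift m δ (ψ i) ▸ measurableSet_sigmaSet δ ((ψ i).shift m))
    (fun i => volume_sigmaSet δ (ψ i) ▸ ENNReal.ofReal_ne_top) (fun i => ?_) (fun i => ?_) ?_ a
  · rw [← sigmaSet_shift, volume_sigmaSet, volume_sigmaSet]
    rfl
  · rw [tauSigmaSet_eq, sigmaSet_eq]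
    exact disjoint_gridCell _ _ (by omega)
  · intro i j hj x hx y hy
    exact mem_sigmaSet_iff_of_isNested h𝓒 (hmem i) (hmem j) (fun h => hj.ne (hinj h))
      (hs i j hj) hx hy

/-- The shift operator on a finite Haar sum over a nested class. -/
theorem eLpNorm_haar_shift_le [Fact (1 ≤ p)] (hβ : UMDBound p X β) (hp : p ≠ ∞) {m : ℤ}
    {δ : Fin 2} {𝓒 : Set DyadicInterval}
    (h𝓒 : IsNested {A : Set ℝ | ∃ I ∈ 𝓒,
      A = I.sigmaSet δ ∨ A = I.tauSigmaSet m δ ∨ A = I.sigmaSet δ ∪ I.tauSigmaSet m δ})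
    (hmem : ∀ i, ψ i ∈ 𝓒)
    (hinj : Function.Injective ψ) (hs : ∀ i, ∀ j < i, (ψ j).scale ≤ (ψ i).scale) (a : ι → X) :
    eLpNorm (fun t => ∑ i, ((ψ i).shift m).haar t • a i) p volume ≤
      (1 + ENNReal.ofReal β) ^ 5 * eLpNorm (fun t => ∑ i, (ψ i).haar t • a i) p volume := by
  set B := ENNReal.ofReal β
  have hB : B ≤ 1 + B := le_add_self
  have h1B : 1 ≤ 1 + B := le_self_add
  set E := eLpNorm (fun t => ∑ i, (ψ i).haar t • a i) p volume
  rcases eq_or_ne m 0 with rfl | hm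
  · simp only [shift_zero]
    calc E = 1 * E := (one_mul E).symm
      _ ≤ _ := by gcongr; exact one_le_pow₀ h1B
  have hinj' : Function.Injective fun i => (ψ i).shift m := (shift_injective m).comp hinj
  have s1 := eLpNorm_haar_le_randNorm_sigmaSet hβ hp hinj' hs a
  have s2 := randNorm_tauSigmaSet_le hβ hp hm h𝓒 hmem hinj hs a
  have s3 := randNorm_sigmaSet_le_eLpNorm_haar hβ hp hinj hs a
  simp only [← sigmaSet_shift] at s2
  by_cases hδ : δ = 0
  · subst hδ
    calc _ ≤ B * (B * (B * E)) := by
          refine s1.trans ?_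
          gcongr
          refine s2.trans ?_
          gcongr
      _ ≤ (1 + B) * ((1 + B) * ((1 + B) * E)) := by gcongr
      _ = (1 + B) ^ 3 * E := by ring
      _ ≤ _ := by gcongr ?_ * _; exact pow_le_pow_right₀ h1B (by norm_num)
  · obtain rfl : δ = 1 := by omega
    -- the standard and the shifted interval contain common halves
    have s4 := randNorm_sigmaSet_le_halfCell hβ hp hinj' hs 0
      (fun i => if levelSign ((ψ i).shift m).scale = 1 then 1 else 0)
      (fun i => by split_ifs <;> simp) a
    have s5 : randNorm p (fun i => (halfCell 0
        (if levelSign ((ψ i).shift m).scale = 1 then 1 else 0) ((ψ i).shift m)).indicator 1) a ≤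
        randNorm p (fun i => (((ψ i).shift m).sigmaSet 1).indicator 1) a :=
      randNorm_indicator_mono hp (fun i => measurableSet_halfCell _ _ _)
        (fun i => measurableSet_sigmaSet _ _) (fun i => halfCell_zero_subset _) a
    have s6 := randNorm_sigmaSet_le_halfCell hβ hp hinj hs 1
      (fun i => if levelSign (ψ i).scale = 1 then 0 else 1)
      (fun i => by split_ifs <;> simp) a
    have s7 : randNorm p (fun i => (halfCell 1
        (if levelSign (ψ i).scale = 1 then 0 else 1) (ψ i)).indicator 1) a ≤
        randNorm p (fun i => ((ψ i).sigmaSet 0).indicator 1) a :=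
      randNorm_indicator_mono hp (fun i => measurableSet_halfCell _ _ _)
        (fun i => measurableSet_sigmaSet _ _) (fun i => halfCell_one_subset _) a
    calc _ ≤ B * ((1 + B) * (B * ((1 + B) * (B * E)))) := by
          refine s1.trans ?_
          gcongr
          refine s4.trans ?_
          gcongr
          refine (s5.trans s2).trans ?_
          gcongr
          refine s6.trans ?_
          gcongr
          exact s7.trans s3
      _ ≤ (1 + B) * ((1 + B) * ((1 + B) * ((1 + B) * ((1 + B) * E)))) := by gcongr
      _ = _ := by ring

end

end DyadicInterval

/-! ### Haar coefficients and density of the Haar sums -/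

namespace DyadicInterval

section

variable {X : Type*} [NormedAddCommGroup X] {p : ℝ≥0∞}

/-- The function `1_I x` as an element of `L^p(ℝ; X)`. -/
def cellLp (p : ℝ≥0∞) (I : DyadicInterval) (x : X) : Lp X p (volume : Measure ℝ) :=
  indicatorConstLp p (measurableSet_sigmaSet 0 I)
    (volume_sigmaSet 0 I ▸ ENNReal.ofReal_ne_top) x

theorem norm_cellLp [Fact (1 ≤ p)] (ht : p ≠ ∞) (I : DyadicInterval) (x : X) :
    ‖cellLp p I x‖ = ‖x‖ * I.length ^ (1 / p.toReal) := by
  rw [cellLp, norm_indicatorConstLp (one_pos.trans_le (Fact.out : 1 ≤ p)).ne' ht, measureReal_def,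
    volume_sigmaSet, ENNReal.toReal_ofReal I.length_pos.le]

variable [NormedSpace ℝ X]

theorem coeFn_haarLp (I : DyadicInterval) (x : X) :
    haarLp p I x =ᵐ[volume] fun t => I.haar t • x := MemLp.coeFn_toLp _

theorem memLp_haar (q : ℝ≥0∞) (I : DyadicInterval) : MemLp I.haar q volume := by
  simpa using memLp_haar_smul (X := ℝ) q I 1

/-- The map `x ↦ h_I x` from `X` to `L^p(ℝ; X)`. -/
def haarLpCLM (p : ℝ≥0∞) [Fact (1 ≤ p)] (X : Type*) [NormedAddCommGroup X] [NormedSpace ℝ X]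
    (I : DyadicInterval) : X →L[ℝ] Lp X p (volume : Measure ℝ) :=
  LinearMap.mkContinuous
    { toFun := haarLp p I
      map_add' := fun x y => by
        rw [haarLp, haarLp, haarLp, ← MemLp.toLp_add]
        congr 1
        funext t
        exact smul_add _ _ _
      map_smul' := fun c x => by
        rw [haarLp, haarLp, RingHom.id_apply, ← MemLp.toLp_const_smul]
        congr 1
        funext t
        exact smul_comm _ _ _ }
    (eLpNorm I.haar p volume).toReal fun x => by
      change ‖haarLp p I x‖ ≤ _
      have h : eLpNorm (haarLp p I x) p volume ≤
          eLpNorm I.haar p volume * ENNReal.ofReal ‖x‖ := by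
        rw [mul_comm, eLpNorm_congr_ae (coeFn_haarLp I x)]
        refine eLpNorm_le_mul_eLpNorm_of_ae_le_mul (ae_of_all _ fun t => ?_) p
        rw [norm_smul, mul_comm]
      have h' := ENNReal.toReal_mono
        (ENNReal.mul_ne_top (memLp_haar p I).eLpNorm_ne_top ENNReal.ofReal_ne_top) h
      rwa [ENNReal.toReal_mul, ENNReal.toReal_ofReal (norm_nonneg _), ← Lp.norm_def] at h'

@[simp]
theorem haarLpCLM_apply [Fact (1 ≤ p)] (I : DyadicInterval) (x : X) :
    haarLpCLM p X I x = haarLp p I x := rfl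

/-- The Haar coefficient is a bounded operator from `L^p(ℝ; X)` to `X`. -/
theorem exists_haarCoeffCLM [Fact (1 ≤ p)] [CompleteSpace X] (I : DyadicInterval) :
    ∃ c : Lp X p (volume : Measure ℝ) →L[ℝ] X, ∀ u, c u = haarCoeff I u := by
  have hq : Fact (1 ≤ ENNReal.conjExponent p) := ⟨by simp [ENNReal.conjExponent]⟩
  let B : X →L[ℝ] ℝ →L[ℝ] X := (ContinuousLinearMap.lsmul ℝ ℝ : ℝ →L[ℝ] X →L[ℝ] X).flip
  let h : Lp ℝ (ENNReal.conjExponent p) (volume : Measure ℝ) := (memLp_haar _ I).toLp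
  refine ⟨(B.lpPairing volume p (ENNReal.conjExponent p)).flip h, fun u => ?_⟩
  rw [ContinuousLinearMap.flip_apply, ContinuousLinearMap.lpPairing_eq_integral, haarCoeff]
  refine integral_congr_ae ?_
  filter_upwards [MemLp.coeFn_toLp (memLp_haar (ENNReal.conjExponent p) I)] with t ht
  change h t • u t = _
  rw [ht]

/-- The Haar coefficient as a bounded operator. -/
def haarCoeffCLM (p : ℝ≥0∞) [Fact (1 ≤ p)] (X : Type*) [NormedAddCommGroup X] [NormedSpace ℝ X]
    [CompleteSpace X] (I : DyadicInterval) : Lp X p (volume : Measure ℝ) →L[ℝ] X :=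
  (exists_haarCoeffCLM I).choose

@[simp]
theorem haarCoeffCLM_apply [Fact (1 ≤ p)] [CompleteSpace X] (I : DyadicInterval)
    (u : Lp X p (volume : Measure ℝ)) : haarCoeffCLM p X I u = haarCoeff I u :=
  (exists_haarCoeffCLM I).choose_spec u

theorem integral_haar_mul_haar_of_lt {I J : DyadicInterval} (h : I < J) :
    ∫ t, I.haar t * J.haar t = 0 := by
  obtain ⟨x, hx⟩ := sigmaSet_nonempty 0 J
  have e : (fun t => I.haar t * J.haar t) = fun t => I.haar x * J.haar t := by
    funext t
    by_cases ht : t ∈ J.sigmaSet 0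
    · classical
      simp only [haar_eq_sub I, Set.indicator_apply, Pi.one_apply,
        mem_halfCell_iff h.ne (scale_le_of_lt h) hx ht (Or.inl rfl),
        mem_halfCell_iff h.ne (scale_le_of_lt h) hx ht (Or.inr rfl)]
    · rw [haar_of_notMem ht, mul_zero, mul_zero]
  rw [e, integral_const_mul, integral_haar, mul_zero]

theorem integral_haar_mul_haar (I J : DyadicInterval) :
    ∫ t, I.haar t * J.haar t = if I = J then I.length else 0 := by
  split_ifs with h
  · subst h
    have e : (fun t => I.haar t * I.haar t) = (I.sigmaSet 0).indicator 1 := by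
      funext t
      rw [← abs_mul_abs_self, abs_haar]
      by_cases ht : t ∈ I.sigmaSet 0 <;> simp [ht]
    rw [e, integral_indicator_one (measurableSet_sigmaSet 0 I), measureReal_def, volume_sigmaSet,
      ENNReal.toReal_ofReal I.length_pos.le]
  · rcases lt_or_gt_of_ne h with h | h
    · exact integral_haar_mul_haar_of_lt h
    · simp_rw [mul_comm (I.haar _)]
      exact integral_haar_mul_haar_of_lt h

theorem haarCoeff_haarLp [CompleteSpace X] (I J : DyadicInterval) (x : X) :
    haarCoeff I (haarLp p J x) = if I = J then I.length • x else 0 := by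
  have e : haarCoeff I (haarLp p J x) = ∫ t, (I.haar t * J.haar t) • x := by
    refine integral_congr_ae ?_
    filter_upwards [coeFn_haarLp (p := p) J x] with t ht
    rw [ht, smul_smul]
  rw [e, integral_smul_const, integral_haar_mul_haar]
  split_ifs <;> simp

/-- The finite Haar sums. -/
def haarSum (p : ℝ≥0∞) [Fact (1 ≤ p)] (X : Type*) [NormedAddCommGroup X] [NormedSpace ℝ X] :
    (DyadicInterval →₀ X) →ₗ[ℝ] Lp X p (volume : Measure ℝ) :=
  Finsupp.lsum ℝ fun I => (haarLpCLM p X I).toLinearMap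

theorem haarSum_apply [Fact (1 ≤ p)] (f : DyadicInterval →₀ X) :
    haarSum p X f = ∑ I ∈ f.support, haarLp p I (f I) := rfl

theorem haarLp_mem_range_haarSum [Fact (1 ≤ p)] (I : DyadicInterval) (x : X) :
    haarLp p I x ∈ LinearMap.range (haarSum p X) :=
  ⟨Finsupp.single I x, by rw [haarSum, Finsupp.lsum_single]; rfl⟩

/-- The dyadic interval of twice the length that contains `I`. -/
def parent (I : DyadicInterval) : DyadicInterval := ⟨I.scale - 1, I.pos / 2⟩

theorem length_parent (I : DyadicInterval) : I.parent.length = 2 * I.length := by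
  rw [length, length, parent, neg_sub, sub_eq_add_neg, zpow_add₀ (by norm_num : (2 : ℝ) ≠ 0),
    zpow_one]

/-- The indicator of `I` is half the indicator of the parent plus or minus half its Haar
function. -/
theorem exists_indicator_eq_parent (I : DyadicInterval) : ∃ s : ℝ, ∀ t,
    (I.sigmaSet 0).indicator (1 : ℝ → ℝ) t =
      s * I.parent.haar t + (1 / 2) * (I.parent.sigmaSet 0).indicator (1 : ℝ → ℝ) t := by
  have hI : ∀ b, I.pos = 2 * (I.pos / 2) + b → I.sigmaSet 0 = halfCell 0 b I.parent := by
    intro b hb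
    rw [sigmaSet_eq, halfCell, parent]
    simp only [sub_add_cancel, Fin.val_zero, Nat.cast_zero, zero_mul, add_zero]
    rw [← hb]
  have hd := disjoint_halfCell 0 I.parent zero_ne_one
  have hu : ∀ t, (I.parent.sigmaSet 0).indicator (1 : ℝ → ℝ) t =
      (halfCell 0 0 I.parent).indicator 1 t + (halfCell 0 1 I.parent).indicator 1 t := by
    intro t
    rw [← halfCell_union, Set.indicator_union_of_disjoint hd]
  rcases Int.emod_two_eq_zero_or_one I.pos with h | h
  · refine ⟨1 / 2, fun t => ?_⟩
    rw [hu, haar_eq_sub, hI 0 (by omega)]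
    ring
  · refine ⟨-(1 / 2), fun t => ?_⟩
    rw [hu, haar_eq_sub, hI 1 (by omega)]
    ring

theorem exists_cellLp_eq_parent [Fact (1 ≤ p)] (I : DyadicInterval) (x : X) : ∃ s : ℝ,
    cellLp p I x = haarLp p I.parent (s • x) + (1 / 2 : ℝ) • cellLp p I.parent x := by
  obtain ⟨s, hs⟩ := exists_indicator_eq_parent I
  refine ⟨s, ?_⟩
  apply Lp.ext
  have e : ∀ (J : DyadicInterval) (t : ℝ), (J.sigmaSet 0).indicator (fun _ => x) t =
      (J.sigmaSet 0).indicator (1 : ℝ → ℝ) t • x := by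
    intro J t
    by_cases h : t ∈ J.sigmaSet 0 <;> simp [h]
  have hc : ∀ J : DyadicInterval, cellLp p J x =ᵐ[volume]
      fun t => (J.sigmaSet 0).indicator (1 : ℝ → ℝ) t • x := fun J =>
    indicatorConstLp_coeFn.trans (ae_of_all _ (e J))
  filter_upwards [hc I, hc I.parent, coeFn_haarLp (p := p) I.parent (s • x),
    Lp.coeFn_add (haarLp p I.parent (s • x)) ((1 / 2 : ℝ) • cellLp p I.parent x),
    Lp.coeFn_smul (1 / 2 : ℝ) (cellLp p I.parent x)] with t h1 h2 h3 h4 h5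
  rw [h1, h4, Pi.add_apply, h3, h5, Pi.smul_apply, h2, hs, add_smul, mul_comm, mul_smul, mul_smul]

/-- The indicator of a dyadic interval is a limit of Haar sums: its mean over the `n`-th ancestor
has norm `2 ^ (-n)` times `2 ^ (n / p)`. -/
theorem cellLp_mem_closure [Fact (1 ≤ p)] (h1 : 1 < p) (ht : p ≠ ∞) (I : DyadicInterval) (x : X) :
    cellLp p I x ∈ (LinearMap.range (haarSum p X)).topologicalClosure := by
  have step : ∀ n : ℕ, ∃ v ∈ LinearMap.range (haarSum p X),
      cellLp p I x = v + (1 / 2 : ℝ) ^ n • cellLp p (parent^[n] I) x := by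
    intro n
    induction n with
    | zero => exact ⟨0, zero_mem _, by simp⟩
    | succ n ih =>
      obtain ⟨v, hv, hvx⟩ := ih
      obtain ⟨s, hs⟩ := exists_cellLp_eq_parent (p := p) (parent^[n] I) x
      refine ⟨v + (1 / 2 : ℝ) ^ n • haarLp p (parent^[n] I).parent (s • x),
        add_mem hv (Submodule.smul_mem _ _ (haarLp_mem_range_haarSum _ _)), ?_⟩
      rw [hvx, hs, smul_add, smul_smul, ← pow_succ, Function.iterate_succ_apply', add_assoc]
  have hlen : ∀ n : ℕ, (parent^[n] I).length = 2 ^ n * I.length := by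
    intro n
    induction n with
    | zero => simp
    | succ n ih => rw [Function.iterate_succ_apply', length_parent, ih, pow_succ]; ring
  choose v hv hvx using step
  have hp1 : 1 < p.toReal := by
    rw [← ENNReal.toReal_one]
    exact (ENNReal.toReal_lt_toReal ENNReal.one_ne_top ht).2 h1
  set r : ℝ := (1 / 2) * 2 ^ (1 / p.toReal) with hr
  have hr0 : 0 ≤ r := by positivity
  have hr1 : r < 1 := by
    have : (2 : ℝ) ^ (1 / p.toReal) < 2 ^ (1 : ℝ) :=
      Real.rpow_lt_rpow_of_exponent_lt (by norm_num) ((div_lt_one (by linarith)).2 hp1)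
    rw [Real.rpow_one] at this
    rw [hr]
    linarith
  have hnorm : ∀ n, ‖v n - cellLp p I x‖ ≤ r ^ n * (‖x‖ * I.length ^ (1 / p.toReal)) := by
    intro n
    have : v n - cellLp p I x = -((1 / 2 : ℝ) ^ n • cellLp p (parent^[n] I) x) := by
      conv_lhs => rw [hvx n]
      abel
    rw [this, norm_neg, norm_smul, norm_cellLp ht, hlen,
      Real.mul_rpow (by positivity) I.length_pos.le, norm_pow, hr, mul_pow,
      ← Real.rpow_natCast (2 ^ (1 / p.toReal)), ← Real.rpow_mul (by norm_num),
      mul_comm (1 / p.toReal),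
      Real.rpow_mul (by norm_num), Real.rpow_natCast, Real.norm_of_nonneg (by norm_num)]
    apply le_of_eq
    ring
  refine mem_closure_of_tendsto (b := Filter.atTop) (f := v) ?_ (Filter.Eventually.of_forall hv)
  rw [tendsto_iff_norm_sub_tendsto_zero]
  refine squeeze_zero (fun _ => norm_nonneg _) hnorm ?_
  simpa using (tendsto_pow_atTop_nhds_zero_of_lt_one hr0 hr1).mul_const
    (‖x‖ * I.length ^ (1 / p.toReal))

/-- Continuous functions of compact support are uniform limits of dyadic step functions, so the
finite Haar sums are dense in `L^p(ℝ; X)` for `1 < p < ∞`. -/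
theorem topologicalClosure_range_haarSum [Fact (1 ≤ p)] (h1 : 1 < p) (ht : p ≠ ∞) :
    (LinearMap.range (haarSum p X)).topologicalClosure = ⊤ := by
  set W := (LinearMap.range (haarSum p X)).topologicalClosure
  rw [eq_top_iff]
  rintro u -
  have hcl : IsClosed (W : Set (Lp X p (volume : Measure ℝ))) :=
    Submodule.isClosed_topologicalClosure _
  rw [← SetLike.mem_coe, ← hcl.closure_eq, Metric.mem_closure_iff]
  intro ε hε
  obtain ⟨g, hgs, hgu, hgc, hgm⟩ := (Lp.memLp u).exists_hasCompactSupport_eLpNorm_sub_le ht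
    (ε := ENNReal.ofReal (ε / 4)) (by simpa using hε)
  obtain ⟨R, hR⟩ := hgs.isCompact.isBounded.subset_closedBall 0
  obtain ⟨N, hN⟩ := exists_nat_gt R
  have hg0 : ∀ t, t ∉ Set.Ico (-(N : ℝ)) N → g t = 0 := by
    intro t h
    by_contra hne
    have := hR (subset_tsupport g hne)
    rw [Metric.mem_closedBall, dist_zero_right, Real.norm_eq_abs, abs_le] at this
    exact h ⟨by linarith, by linarith⟩
  set V : ℝ≥0∞ := volume (Set.Ico (-(N : ℝ)) N) ^ (1 / p.toReal) with hV
  have hVt : V ≠ ∞ := ENNReal.rpow_ne_top_of_nonneg (by positivity) (by simp)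
  obtain ⟨η, hη, hηV⟩ : ∃ η : ℝ, 0 < η ∧ V * ENNReal.ofReal η ≤ ENNReal.ofReal (ε / 4) := by
    refine ⟨ε / 4 / (V.toReal + 1), by positivity, ?_⟩
    rw [← ENNReal.ofReal_toReal hVt, ← ENNReal.ofReal_mul ENNReal.toReal_nonneg,
      ENNReal.toReal_ofReal ENNReal.toReal_nonneg]
    refine ENNReal.ofReal_le_ofReal ?_
    rw [mul_div_assoc', div_le_iff₀ (by positivity), mul_comm]
    gcongr
    linarith
  obtain ⟨d, hd, hgd⟩ := Metric.uniformContinuous_iff.1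
    (hgs.uniformContinuous_of_continuous hgc) η hη
  obtain ⟨n, hn⟩ := exists_pow_lt_of_lt_one hd (by norm_num : (1 / 2 : ℝ) < 1)
  -- the step function takes on each cell of level `n` the value of `g` at the left end point
  let c : ℤ → ℝ := fun k => (1 / 2 : ℝ) ^ n * k
  let s : Finset ℤ := Finset.Ico (-(N * 2 ^ n : ℤ)) (N * 2 ^ n)
  let w : Lp X p (volume : Measure ℝ) := ∑ k ∈ s, cellLp p ⟨n, k⟩ (g (c k))
  have hw : w ∈ W := Submodule.sum_mem _ fun k _ => cellLp_mem_closure h1 ht _ _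
  refine ⟨w, hw, ?_⟩
  have h2n : (1 / 2 : ℝ) ^ n * 2 ^ n = 1 := by rw [← mul_pow]; norm_num
  have hpos : (0 : ℝ) < 2 ^ n := by positivity
  have hwae : w =ᵐ[volume] fun t => if t ∈ Set.Ico (-(N : ℝ)) N then
      g (c (gridIndex 0 n t)) else 0 := by
    have hcell : ∀ᵐ t, ∀ k ∈ s, cellLp p ⟨n, k⟩ (g (c k)) t =
        (sigmaSet 0 ⟨n, k⟩).indicator (fun _ => g (c k)) t :=
      (Finset.eventually_all s).2 fun k _ => indicatorConstLp_coeFn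
    filter_upwards [Lp.coeFn_finsetSum s fun k => cellLp p ⟨n, k⟩ (g (c k)), hcell]
      with t hsum hk
    rw [hsum, Finset.sum_apply, Finset.sum_congr rfl hk]
    have hind : ∀ k : ℤ, (sigmaSet 0 ⟨n, k⟩).indicator (fun _ => g (c k)) t =
        if gridIndex 0 n t = k then g (c k) else 0 := by
      intro k
      rw [sigmaSet_eq]
      by_cases h : gridIndex 0 n t = k
      · rw [if_pos h]
        exact Set.indicator_of_mem (s := gridCell 0 n k) h _
      · rw [if_neg h]
        exact Set.indicator_of_notMem (s := gridCell 0 n k) h _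
    simp only [hind, Finset.sum_ite_eq]
    have hmem : gridIndex 0 n t ∈ s ↔ t ∈ Set.Ico (-(N : ℝ)) N := by
      simp only [s, Finset.mem_Ico, gridIndex, Int.le_floor, Int.floor_lt, Set.mem_Ico,
        Fin.val_zero, Nat.cast_zero, zero_mul, zero_div, sub_zero, zpow_natCast]
      push_cast
      rw [← neg_mul, mul_comm (2 ^ n : ℝ) t, mul_le_mul_iff_left₀ hpos, mul_lt_mul_iff_left₀ hpos]
    simp only [hmem]
  have hclose : ∀ t, ‖(if t ∈ Set.Ico (-(N : ℝ)) N then g (c (gridIndex 0 n t)) else 0) - g t‖ ≤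
      η := by
    intro t
    split_ifs with h
    · rw [← dist_eq_norm]
      refine (hgd ?_).le
      have h1 := Int.floor_le ((2 : ℝ) ^ (n : ℤ) * t - (((0 : Fin 2) : ℕ) : ℝ) * levelSign n / 3)
      have h2 := Int.lt_floor_add_one
        ((2 : ℝ) ^ (n : ℤ) * t - (((0 : Fin 2) : ℕ) : ℝ) * levelSign n / 3)
      rw [← gridIndex] at h1 h2
      simp only [Fin.val_zero, Nat.cast_zero, zero_mul, zero_div, sub_zero, zpow_natCast] at h1 h2
      have hhalf : (0 : ℝ) < (1 / 2) ^ n := by positivity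
      have e : (1 / 2 : ℝ) ^ n * (2 ^ n * t) = t := by rw [← mul_assoc, h2n, one_mul]
      have h1' := mul_le_mul_of_nonneg_left h1 hhalf.le
      have h2' := mul_lt_mul_of_pos_left h2 hhalf
      rw [e] at h1' h2'
      rw [Real.dist_eq, abs_lt]
      constructor <;> simp only [c] <;> linarith
    · rw [hg0 t h, sub_zero, norm_zero]
      exact hη.le
  have hwg : eLpNorm (⇑w - g) p volume ≤ ENNReal.ofReal (ε / 4) := by
    set F : ℝ → X := fun t =>
      (if t ∈ Set.Ico (-(N : ℝ)) N then g (c (gridIndex 0 n t)) else 0) - g t with hF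
    have e1 : eLpNorm (⇑w - g) p volume = eLpNorm F p volume := by
      refine eLpNorm_congr_ae ?_
      filter_upwards [hwae] with t h
      rw [Pi.sub_apply, h]
    have e2 : eLpNorm F p (volume.restrict (Set.Ico (-(N : ℝ)) N)) = eLpNorm F p volume := by
      refine eLpNorm_restrict_eq_of_support_subset fun t h => ?_
      by_contra hne
      exact h (by simp only [hF, if_neg hne, hg0 t hne, sub_zero])
    rw [e1, ← e2]
    refine (eLpNorm_le_of_ae_bound (C := η) (ae_of_all _ hclose)).trans (le_trans (le_of_eq ?_) hηV)
    rw [Measure.restrict_apply_univ, hV, one_div]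
  have htot : eLpNorm (⇑u - ⇑w) p volume ≤ ENNReal.ofReal (ε / 2) := by
    have e : ⇑u - ⇑w = (⇑u - g) + (g - ⇑w) := by abel
    rw [e]
    refine (eLpNorm_add_le ((Lp.aestronglyMeasurable u).sub hgm.1)
      (hgm.1.sub (Lp.aestronglyMeasurable w)) h1.le).trans ?_
    rw [eLpNorm_sub_comm g]
    refine (add_le_add hgu hwg).trans (le_of_eq ?_)
    rw [← ENNReal.ofReal_add (by positivity) (by positivity)]
    congr 1
    ring
  rw [dist_eq_norm, Lp.norm_def, eLpNorm_congr_ae (Lp.coeFn_sub u w)]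
  refine lt_of_le_of_lt (ENNReal.toReal_mono ENNReal.ofReal_ne_top htot) ?_
  rw [ENNReal.toReal_ofReal (by positivity)]
  linarith

end

end DyadicInterval

/-! ### Haar series as operators -/

namespace DyadicInterval

section

variable {X : Type*} [NormedAddCommGroup X] [NormedSpace ℝ X] {p : ℝ≥0∞}

theorem norm_sum_haarLp [Fact (1 ≤ p)] (s : Finset DyadicInterval)
    (φ : DyadicInterval → DyadicInterval) (a : DyadicInterval → X) :
    ‖∑ I ∈ s, haarLp p (φ I) (a I)‖ =
      (eLpNorm (fun t => ∑ i : s, (φ i).haar t • a i) p volume).toReal := by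
  rw [Lp.norm_def]
  congr 1
  refine eLpNorm_congr_ae ?_
  have h : ∀ᵐ t, ∀ I ∈ s, haarLp p (φ I) (a I) t = (φ I).haar t • a I :=
    (Finset.eventually_all s).2 fun I _ => coeFn_haarLp _ _
  filter_upwards [Lp.coeFn_finsetSum s fun I => haarLp p (φ I) (a I), h] with t h1 h2
  rw [h1, Finset.sum_apply, Finset.sum_congr rfl h2, ← Finset.sum_coe_sort s]

theorem eLpNorm_sum_haar_ne_top (s : Finset DyadicInterval)
    (φ : DyadicInterval → DyadicInterval) (a : DyadicInterval → X) :
    eLpNorm (fun t => ∑ i : s, (φ i).haar t • a i) p volume ≠ ∞ :=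
  (memLp_finsetSum Finset.univ fun (i : s) _ => memLp_haar_smul p (φ i) (a i)).eLpNorm_ne_top

theorem haarLp_smul [Fact (1 ≤ p)] (c : ℝ) (I : DyadicInterval) (x : X) :
    haarLp p I (c • x) = c • haarLp p I x := (haarLpCLM p X I).map_smul c x

/-- A closed condition on `u ∈ L^p(ℝ; X)` may be checked on finite Haar sums. -/
theorem haarSum_induction [Fact (1 ≤ p)] (h1 : 1 < p) (ht : p ≠ ∞)
    {P : Lp X p (volume : Measure ℝ) → Prop} (hP : IsClosed {u | P u})
    (h : ∀ f, P (haarSum p X f)) (u : Lp X p (volume : Measure ℝ)) : P u := by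
  have hu : u ∈ (LinearMap.range (haarSum p X)).topologicalClosure := by
    rw [topologicalClosure_range_haarSum h1 ht]
    trivial
  refine closure_minimal (t := {u | P u}) ?_ hP hu
  rintro _ ⟨f, rfl⟩
  exact h f

variable [CompleteSpace X] {β : ℝ}

theorem norm_sum_haarLp_shift_le [Fact (1 ≤ p)] (hβ : UMDBound p X β) (hβ0 : 0 ≤ β) (hp : p ≠ ∞)
    {m : ℤ} {δ : Fin 2} {𝓒 : Set DyadicInterval}
    (h𝓒 : IsNested {A : Set ℝ | ∃ I ∈ 𝓒,
      A = I.sigmaSet δ ∨ A = I.tauSigmaSet m δ ∨ A = I.sigmaSet δ ∪ I.tauSigmaSet m δ})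
    {s : Finset DyadicInterval} (hs : ↑s ⊆ 𝓒) (a : DyadicInterval → X) :
    ‖∑ I ∈ s, haarLp p (I.shift m) (a I)‖ ≤ (1 + β) ^ 5 * ‖∑ I ∈ s, haarLp p I (a I)‖ := by
  have key := eLpNorm_haar_shift_le hβ hp h𝓒 (ψ := fun i : s => (i : DyadicInterval))
    (fun i => hs i.2) Subtype.val_injective (fun i j hj => scale_le_of_lt hj) fun i => a i
  have hfin := eLpNorm_sum_haar_ne_top (p := p) s id a
  have h1 : (1 + ENNReal.ofReal β) ^ 5 = ENNReal.ofReal ((1 + β) ^ 5) := by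
    rw [ENNReal.ofReal_pow (by linarith), ENNReal.ofReal_add zero_le_one hβ0, ENNReal.ofReal_one]
  rw [h1] at key
  have := ENNReal.toReal_mono (ENNReal.mul_ne_top ENNReal.ofReal_ne_top hfin) key
  rw [ENNReal.toReal_mul, ENNReal.toReal_ofReal (by positivity)] at this
  rw [norm_sum_haarLp s (shift m) a]
  refine this.trans (le_of_eq ?_)
  congr 1
  exact (norm_sum_haarLp s id a).symm

theorem norm_sum_haarLp_sign_le [Fact (1 ≤ p)] (hβ : UMDBound p X β) (hβ0 : 0 ≤ β) (hp : p ≠ ∞)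
    (s : Finset DyadicInterval) (a : DyadicInterval → X) (ε : DyadicInterval → ℝ)
    (hε : ∀ I, ε I = 1 ∨ ε I = -1) :
    ‖∑ I ∈ s, ε I • haarLp p I (a I)‖ ≤ β * ‖∑ I ∈ s, haarLp p I (a I)‖ := by
  have key := eLpNorm_haar_sign_le hβ hp (ψ := fun i : s => (i : DyadicInterval))
    Subtype.val_injective (fun i j hj => scale_le_of_lt hj) (fun i => a i) (fun i => ε i)
    fun i => hε i
  have hfin := eLpNorm_sum_haar_ne_top (p := p) s id a
  have := ENNReal.toReal_mono (ENNReal.mul_ne_top ENNReal.ofReal_ne_top hfin) key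
  rw [ENNReal.toReal_mul, ENNReal.toReal_ofReal hβ0] at this
  simp only [smul_comm (ε _)] at this
  simp only [← haarLp_smul]
  refine (norm_sum_haarLp s id fun I => ε I • a I).le.trans ?_
  refine this.trans (le_of_eq ?_)
  congr 1
  exact (norm_sum_haarLp s id a).symm

theorem norm_sum_haarLp_le_of_subset [Fact (1 ≤ p)] (hβ : UMDBound p X β) (hβ0 : 0 ≤ β)
    (hp : p ≠ ∞) {s t : Finset DyadicInterval} (hst : s ⊆ t) (a : DyadicInterval → X) :
    ‖∑ I ∈ s, haarLp p I (a I)‖ ≤ (1 + β) * ‖∑ I ∈ t, haarLp p I (a I)‖ := by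
  have h := norm_sum_haarLp_sign_le hβ hβ0 hp t a (fun I => if I ∈ s then 1 else -1)
    fun I => by split_ifs <;> simp
  -- the coefficients `0, 1` are the means of `1` and a sign
  have e : (2 : ℝ) • ∑ I ∈ s, haarLp p I (a I) = ∑ I ∈ t, haarLp p I (a I) +
      ∑ I ∈ t, (if I ∈ s then (1 : ℝ) else -1) • haarLp p I (a I) := by
    rw [← Finset.sum_add_distrib, ← Finset.inter_eq_right.2 hst, ← Finset.filter_mem_eq_inter,
      Finset.sum_filter, Finset.smul_sum]
    refine Finset.sum_congr rfl fun I hI => ?_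
    by_cases h : I ∈ s
    · simp [h, hI, two_smul]
    · simp [h]
  have h2 : 2 * ‖∑ I ∈ s, haarLp p I (a I)‖ ≤ (1 + β) * ‖∑ I ∈ t, haarLp p I (a I)‖ := by
    rw [← Real.norm_ofNat 2, ← norm_smul, e, add_mul, one_mul]
    exact (norm_add_le _ _).trans (add_le_add le_rfl h)
  have := norm_nonneg (∑ I ∈ s, haarLp p I (a I))
  linarith

/-- The `I`-th term of the Haar series of `u`, with `h_I` replaced by `h_{φ I}`. -/
def haarTerm (p : ℝ≥0∞) [Fact (1 ≤ p)] (X : Type*) [NormedAddCommGroup X] [NormedSpace ℝ X]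
    [CompleteSpace X] (φ : DyadicInterval → DyadicInterval) (I : DyadicInterval) :
    Lp X p (volume : Measure ℝ) →L[ℝ] Lp X p (volume : Measure ℝ) :=
  I.length⁻¹ • (haarLpCLM p X (φ I)).comp (haarCoeffCLM p X I)

theorem haarTerm_apply [Fact (1 ≤ p)] (φ : DyadicInterval → DyadicInterval) (I : DyadicInterval)
    (u : Lp X p (volume : Measure ℝ)) :
    haarTerm p X φ I u = I.length⁻¹ • haarLp p (φ I) (haarCoeff I u) := by
  simp [haarTerm]

theorem haarTerm_haarLp [Fact (1 ≤ p)] (φ : DyadicInterval → DyadicInterval)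
    (I J : DyadicInterval) (x : X) :
    haarTerm p X φ I (haarLp p J x) = if I = J then haarLp p (φ J) x else 0 := by
  rw [haarTerm_apply, haarCoeff_haarLp]
  split_ifs with h
  · subst h
    rw [haarLp_smul, smul_smul, inv_mul_cancel₀ I.length_pos.ne', one_smul]
  · rw [← haarLpCLM_apply, map_zero, smul_zero]

theorem haarTerm_haarSum [Fact (1 ≤ p)] (φ : DyadicInterval → DyadicInterval)
    (I : DyadicInterval) (f : DyadicInterval →₀ X) :
    haarTerm p X φ I (haarSum p X f) = haarLp p (φ I) (f I) := by
  rw [haarSum_apply, map_sum]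
  simp only [haarTerm_haarLp, Finset.sum_ite_eq]
  split_ifs with h
  · rfl
  · rw [Finsupp.notMem_support_iff.1 h, ← haarLpCLM_apply, map_zero]

theorem norm_sum_haarTerm_le [Fact (1 ≤ p)] (h1 : 1 < p) (hp : p ≠ ∞) (hβ : UMDBound p X β)
    (hβ0 : 0 ≤ β) (s : Finset DyadicInterval) (u : Lp X p (volume : Measure ℝ)) :
    ‖∑ I ∈ s, haarTerm p X id I u‖ ≤ (1 + β) * ‖u‖ := by
  refine haarSum_induction h1 hp
    (P := fun u => ‖∑ I ∈ s, haarTerm p X id I u‖ ≤ (1 + β) * ‖u‖)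
    (isClosed_le ?_ ?_) (fun f => ?_) u
  · exact (continuous_finsetSum s fun I _ => (haarTerm p X id I).continuous).norm
  · exact continuous_const.mul continuous_norm
  · simp only [haarTerm_haarSum, id]
    refine (norm_sum_haarLp_le_of_subset hβ hβ0 hp (t := s ∪ f.support)
      Finset.subset_union_left f).trans (le_of_eq ?_)
    rw [haarSum_apply]
    congr 2
    refine (Finset.sum_subset Finset.subset_union_right fun I _ hI => ?_).symm
    rw [Finsupp.notMem_support_iff.1 hI, ← haarLpCLM_apply, map_zero]

/-- If replacing `h_I` by `h_{φ I}`, `I ∈ 𝓒`, is bounded on finite Haar sums, then it defines a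
bounded operator by an unconditionally convergent series. -/
theorem exists_hasSum_haarTerm [Fact (1 ≤ p)] (h1 : 1 < p) (hp : p ≠ ∞) (hβ : UMDBound p X β)
    (hβ0 : 0 ≤ β) (φ : DyadicInterval → DyadicInterval) (𝓒 : Set DyadicInterval) {A : ℝ}
    (hA0 : 0 ≤ A)
    (hA : ∀ s : Finset DyadicInterval, ↑s ⊆ 𝓒 → ∀ a : DyadicInterval → X,
      ‖∑ I ∈ s, haarLp p (φ I) (a I)‖ ≤ A * ‖∑ I ∈ s, haarLp p I (a I)‖) :
    ∃ Q : Lp X p (volume : Measure ℝ) →L[ℝ] Lp X p (volume : Measure ℝ),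
      (∀ u, HasSum (fun I : 𝓒 => haarTerm p X φ I u) (Q u)) ∧
      ∀ u, ‖Q u‖ ≤ A * (1 + β) * ‖u‖ := by
  classical
  have hbd : ∀ (s : Finset 𝓒) (u : Lp X p (volume : Measure ℝ)),
      ‖∑ I ∈ s, haarTerm p X φ I u‖ ≤ A * (1 + β) * ‖u‖ := by
    intro s u
    have hsub : ((s.map (Function.Embedding.subtype _) : Finset DyadicInterval) : Set _) ⊆ 𝓒 := by
      intro I hI
      simp only [Finset.coe_map, Set.mem_image] at hI
      obtain ⟨J, _, rfl⟩ := hI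
      exact J.2
    have h := hA _ hsub fun I => I.length⁻¹ • haarCoeff I u
    have h' := norm_sum_haarTerm_le h1 hp hβ hβ0 (s.map (Function.Embedding.subtype _)) u
    simp only [haarLp_smul, Finset.sum_map, Function.Embedding.coe_subtype] at h
    simp only [haarTerm_apply, id, Finset.sum_map, Function.Embedding.coe_subtype] at h' ⊢
    rw [mul_assoc]
    exact h.trans (mul_le_mul_of_nonneg_left h' hA0)
  have hsummable : ∀ u : Lp X p (volume : Measure ℝ),
      Summable fun I : 𝓒 => haarTerm p X φ I u := by
    intro u
    refine haarSum_induction h1 hp (P := fun u => Summable fun I : 𝓒 => haarTerm p X φ I u) ?_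
      (fun f => ?_) u
    · -- the uniform bound on finite partial sums carries the Cauchy criterion over to limits
      refine isClosed_of_closure_subset fun u hu => ?_
      rw [Metric.mem_closure_iff] at hu
      change Summable _
      rw [summable_iff_vanishing_norm]
      intro ε hε
      have hc : 0 < A * (1 + β) + 1 := by positivity
      obtain ⟨v, hv, huv⟩ := hu (ε / 2 / (A * (1 + β) + 1)) (by positivity)
      obtain ⟨s, hs⟩ := (summable_iff_vanishing_norm.1 hv) (ε / 2) (half_pos hε)
      refine ⟨s, fun t ht => ?_⟩
      have e : ∑ I ∈ t, haarTerm p X φ I u =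
          ∑ I ∈ t, haarTerm p X φ I (u - v) + ∑ I ∈ t, haarTerm p X φ I v := by
        simp only [map_sub, Finset.sum_sub_distrib, sub_add_cancel]
      rw [e]
      have h3 := hbd t (u - v)
      have h4 : A * (1 + β) * ‖u - v‖ ≤ ε / 2 := by
        rw [dist_eq_norm, lt_div_iff₀ hc] at huv
        nlinarith [norm_nonneg (u - v)]
      linarith [norm_add_le (∑ I ∈ t, haarTerm p X φ I (u - v)) (∑ I ∈ t, haarTerm p X φ I v),
        hs t ht]
    · refine summable_of_ne_finset_zero (s := f.support.subtype (· ∈ 𝓒)) fun I hI => ?_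
      rw [haarTerm_haarSum, Finsupp.notMem_support_iff.1 (by simpa using hI), ← haarLpCLM_apply,
        map_zero]
  refine ⟨LinearMap.mkContinuous
    { toFun := fun u => ∑' I : 𝓒, haarTerm p X φ I u
      map_add' := fun u v => by
        simp only [map_add]
        exact (hsummable u).tsum_add (hsummable v)
      map_smul' := fun c u => by
        simp only [map_smul, RingHom.id_apply]
        exact (hsummable u).tsum_const_smul c } (A * (1 + β)) fun u => ?_,
    fun u => (hsummable u).hasSum, fun u => ?_⟩
  all_goals
    exact le_of_tendsto (hsummable u).hasSum.norm
      (Filter.Eventually.of_forall fun s => hbd s u)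

end

end DyadicInterval

/-! ### The shift operator and its pieces -/

namespace DyadicInterval

section

variable {X : Type*} [NormedAddCommGroup X] [NormedSpace ℝ X] {p : ℝ≥0∞} [Fact (1 ≤ p)]

theorem eq_of_eq_on_haarLp (h1 : 1 < p) (hp : p ≠ ∞)
    {S T : Lp X p (volume : Measure ℝ) →L[ℝ] Lp X p (volume : Measure ℝ)}
    (h : ∀ I x, S (haarLp p I x) = T (haarLp p I x)) (u : Lp X p (volume : Measure ℝ)) :
    S u = T u := by
  refine haarSum_induction h1 hp (P := fun u => S u = T u)
    (isClosed_eq S.continuous T.continuous) (fun f => ?_) u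
  simp only [haarSum_apply, map_sum, h]

variable [CompleteSpace X]

theorem isHaarProjection_iff {𝓑 : Set DyadicInterval}
    {P : Lp X p (volume : Measure ℝ) →L[ℝ] Lp X p (volume : Measure ℝ)} :
    IsHaarProjection 𝓑 P ↔ ∀ u, HasSum (fun I : 𝓑 => haarTerm p X id I u) (P u) := by
  simp only [IsHaarProjection, haarTerm_apply, id]

open Classical in
theorem apply_haarLp_of_hasSum {𝓑 : Set DyadicInterval} {φ : DyadicInterval → DyadicInterval}
    {Q : Lp X p (volume : Measure ℝ) →L[ℝ] Lp X p (volume : Measure ℝ)}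
    (hQ : ∀ u, HasSum (fun I : 𝓑 => haarTerm p X φ I u) (Q u)) (J : DyadicInterval) (x : X) :
    Q (haarLp p J x) = if J ∈ 𝓑 then haarLp p (φ J) x else 0 := by
  have h := hQ (haarLp p J x)
  simp only [haarTerm_haarLp] at h
  refine h.unique ?_
  split_ifs with hJ
  · convert hasSum_ite_eq (⟨J, hJ⟩ : 𝓑) (haarLp p (φ J) x) using 3 with I
    exact ⟨fun h => Subtype.ext h, fun h => congrArg Subtype.val h⟩
  · convert hasSum_zero using 2 with I
    exact if_neg fun h : (I : DyadicInterval) = J => hJ (h ▸ I.2)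

theorem sum_apply_haarLp {m : ℤ} {K : ℕ} {𝓑 : Fin 2 → Fin (K + 1) → Set DyadicInterval}
    (h𝓑 : IsShiftDecomposition m K 𝓑) {φ : DyadicInterval → DyadicInterval}
    {Q : Fin 2 → Fin (K + 1) →
      (Lp X p (volume : Measure ℝ) →L[ℝ] Lp X p (volume : Measure ℝ))}
    (hQ : ∀ δ i u, HasSum (fun I : 𝓑 δ i => haarTerm p X φ I u) (Q δ i u))
    (J : DyadicInterval) (x : X) : ∑ δ, ∑ i, Q δ i (haarLp p J x) = haarLp p (φ J) x := by
  classical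
  obtain ⟨δ, hδ⟩ := Set.mem_iUnion.1 (h𝓑.cover.symm ▸ Set.mem_univ J : J ∈ ⋃ δ, ⋃ i, 𝓑 δ i)
  obtain ⟨i, hi⟩ := Set.mem_iUnion.1 hδ
  rw [← Fintype.sum_prod_type', Finset.sum_eq_single (δ, i)]
  · rw [apply_haarLp_of_hasSum (hQ δ i), if_pos hi]
  · rintro ⟨δ', i'⟩ - hne
    rw [apply_haarLp_of_hasSum (hQ δ' i'), if_neg]
    exact fun h => Set.disjoint_left.1 (h𝓑.disjoint hne) h hi
  · simp

variable {β : ℝ}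

theorem exists_isHaarProjection (h1 : 1 < p) (hp : p ≠ ∞) (hβ : UMDBound p X β) (hβ0 : 0 ≤ β)
    (𝓑 : Set DyadicInterval) :
    ∃ P : Lp X p (volume : Measure ℝ) →L[ℝ] Lp X p (volume : Measure ℝ),
      IsHaarProjection 𝓑 P ∧ ∀ u, ‖P u‖ ≤ (1 + β) * ‖u‖ := by
  obtain ⟨P, hP, hPn⟩ := exists_hasSum_haarTerm h1 hp hβ hβ0 id 𝓑 zero_le_one
    fun s _ a => (one_mul ‖∑ I ∈ s, haarLp p I (a I)‖).ge
  exact ⟨P, isHaarProjection_iff.2 hP, fun u => by simpa using hPn u⟩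

theorem IsHaarProjection.norm_apply_le (h1 : 1 < p) (hp : p ≠ ∞) (hβ : UMDBound p X β)
    (hβ0 : 0 ≤ β) {𝓑 : Set DyadicInterval}
    {P : Lp X p (volume : Measure ℝ) →L[ℝ] Lp X p (volume : Measure ℝ)}
    (hP : IsHaarProjection 𝓑 P) (u : Lp X p (volume : Measure ℝ)) : ‖P u‖ ≤ (1 + β) * ‖u‖ := by
  obtain ⟨P', hP', hn⟩ := exists_isHaarProjection h1 hp hβ hβ0 𝓑
  rw [(hP u).unique (hP' u)]
  exact hn u

/-- The shift operator exists: a decomposition into finitely many nested classes reduces its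
boundedness to that of its restrictions to these classes. -/
theorem exists_isShiftOperator (h1 : 1 < p) (hp : p ≠ ∞) (hβ : UMDBound p X β) (hβ0 : 0 ≤ β)
    (m : ℤ) : ∃ T : Lp X p (volume : Measure ℝ) →L[ℝ] Lp X p (volume : Measure ℝ),
      IsShiftOperator m T := by
  obtain ⟨K, 𝓑, -, h𝓑⟩ := exists_isShiftDecomposition m
  have h : ∀ δ i, ∃ Q : Lp X p (volume : Measure ℝ) →L[ℝ] Lp X p (volume : Measure ℝ),
      (∀ u, HasSum (fun I : 𝓑 δ i => haarTerm p X (shift m) I u) (Q u)) ∧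
      ∀ u, ‖Q u‖ ≤ (1 + β) ^ 5 * (1 + β) * ‖u‖ := fun δ i =>
    exists_hasSum_haarTerm h1 hp hβ hβ0 (shift m) (𝓑 δ i) (by positivity)
      fun s hs a => norm_sum_haarLp_shift_le hβ hβ0 hp (h𝓑.nested δ i) hs a
  choose Q hQ _ using h
  refine ⟨∑ δ, ∑ i, Q δ i, fun I x => ?_⟩
  rw [← sum_apply_haarLp h𝓑 hQ I x]
  simp

/-- The bound for finite sums over the class passes to the limit of the two Haar series. -/
theorem norm_shiftOperator_haarProjection_le (hp : p ≠ ∞) (hβ : UMDBound p X β) (hβ0 : 0 ≤ β)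
    {m : ℤ} {δ : Fin 2} {𝓑 : Set DyadicInterval}
    (h𝓑 : IsNested {A : Set ℝ | ∃ I ∈ 𝓑,
      A = I.sigmaSet δ ∨ A = I.tauSigmaSet m δ ∨ A = I.sigmaSet δ ∪ I.tauSigmaSet m δ})
    {T P : Lp X p (volume : Measure ℝ) →L[ℝ] Lp X p (volume : Measure ℝ)}
    (hT : IsShiftOperator m T) (hP : IsHaarProjection 𝓑 P) (u : Lp X p (volume : Measure ℝ)) :
    ‖T (P u)‖ ≤ (1 + β) ^ 5 * ‖P u‖ := by
  classical
  have hTP := (hP u).mapL T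
  refine le_of_tendsto_of_tendsto' hTP.norm ((hP u).norm.const_mul _) fun s => ?_
  have hsub : ((s.map (Function.Embedding.subtype _) : Finset DyadicInterval) : Set _) ⊆ 𝓑 := by
    intro I hI
    simp only [Finset.coe_map, Set.mem_image] at hI
    obtain ⟨J, _, rfl⟩ := hI
    exact J.2
  have h := norm_sum_haarLp_shift_le hβ hβ0 hp h𝓑 hsub fun I => I.length⁻¹ • haarCoeff I u
  simp only [haarLp_smul, Finset.sum_map, Function.Embedding.coe_subtype] at h
  simpa only [map_smul, hT _ _] using h

end

end DyadicInterval

end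

theorem mainTheorem1 :
    (∀ m : ℤ, ∃ (K : ℕ) (𝓑 : Fin 2 → Fin (K + 1) → Set DyadicInterval),
      (K : ℝ) ≤ 7 + 2 * Real.logb 2 (1 + |(m : ℝ)|) ∧ IsShiftDecomposition m K 𝓑) ∧
    ∃ C : ℝ → ℝ,
      ∀ (p : ℝ≥0∞) [Fact (1 ≤ p)], 1 < p → p < ∞ →
      ∀ (X : Type*) [NormedAddCommGroup X] [NormedSpace ℝ X] [CompleteSpace X], IsUMD p X →
      ∀ m : ℤ,
        (∃! T : Lp X p (volume : Measure ℝ) →L[ℝ] Lp X p (volume : Measure ℝ),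
          IsShiftOperator m T) ∧
        ∀ T : Lp X p (volume : Measure ℝ) →L[ℝ] Lp X p (volume : Measure ℝ),
          IsShiftOperator m T →
        ∀ (K : ℕ) (𝓑 : Fin 2 → Fin (K + 1) → Set DyadicInterval),
          IsShiftDecomposition m K 𝓑 →
          (∀ δ i, ∃ P : Lp X p (volume : Measure ℝ) →L[ℝ] Lp X p (volume : Measure ℝ),
            IsHaarProjection (𝓑 δ i) P) ∧
          ∀ P : Fin 2 → Fin (K + 1) →
              (Lp X p (volume : Measure ℝ) →L[ℝ] Lp X p (volume : Measure ℝ)),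
            (∀ δ i, IsHaarProjection (𝓑 δ i) (P δ i)) →
            (∀ u, ∑ δ, ∑ i, P δ i u = u) ∧
            (∀ u, T u = ∑ δ, ∑ i, T (P δ i u)) ∧
            (∀ δ i u, ‖T (P δ i u)‖ ≤ C (umdConst p X) * ‖P δ i u‖) ∧
            (∀ δ i u, ‖T (P δ i u)‖ ≤ C (umdConst p X) * ‖u‖) := by
  refine ⟨exists_isShiftDecomposition, fun x => (1 + x) ^ 6, ?_⟩
  intro p _ h1 hp X _ _ _ hX m
  have hβ := hX.umdBound
  have hβ0 := umdConst_nonneg p X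
  set β := umdConst p X
  refine ⟨?_, fun T hT K 𝓑 h𝓑 => ⟨fun δ i => ?_, fun P hP => ?_⟩⟩
  · obtain ⟨T, hT⟩ := DyadicInterval.exists_isShiftOperator h1 hp.ne hβ hβ0 m
    refine ⟨T, hT, fun S hS => ContinuousLinearMap.ext fun u => ?_⟩
    exact DyadicInterval.eq_of_eq_on_haarLp h1 hp.ne (fun I x => (hS I x).trans (hT I x).symm) u
  · obtain ⟨P, hP, -⟩ := DyadicInterval.exists_isHaarProjection h1 hp.ne hβ hβ0 (𝓑 δ i)
    exact ⟨P, hP⟩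
  have hsum : ∀ u, ∑ δ, ∑ i, P δ i u = u := by
    intro u
    have := DyadicInterval.eq_of_eq_on_haarLp h1 hp.ne (S := ∑ δ, ∑ i, P δ i) (T := .id ℝ _)
      (fun I x => by
        have h := DyadicInterval.sum_apply_haarLp h𝓑
          (fun δ i => DyadicInterval.isHaarProjection_iff.1 (hP δ i)) I x
        simpa using h) u
    simpa using this
  have hTP : ∀ δ i u, ‖T (P δ i u)‖ ≤ (1 + β) ^ 5 * ‖P δ i u‖ := fun δ i u =>
    DyadicInterval.norm_shiftOperator_haarProjection_le hp.ne hβ hβ0 (h𝓑.nested δ i) hT (hP δ i) u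
  refine ⟨hsum, fun u => ?_, fun δ i u => ?_, fun δ i u => ?_⟩
  · conv_lhs => rw [← hsum u]
    simp only [map_sum]
  · refine (hTP δ i u).trans ?_
    exact mul_le_mul_of_nonneg_right (pow_le_pow_right₀ (by linarith) (by norm_num))
      (norm_nonneg _)
  · refine (hTP δ i u).trans ?_
    calc (1 + β) ^ 5 * ‖P δ i u‖ ≤ (1 + β) ^ 5 * ((1 + β) * ‖u‖) := by
          gcongr
          exact DyadicInterval.IsHaarProjection.norm_apply_le h1 hp.ne hβ hβ0 (hP δ i) u
      _ = (1 + β) ^ 6 * ‖u‖ := by ring
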